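/- Notation. For $p\in[1,\infty)$, $\|f\|_p=\left(\int_0^1|f(x)|^p\,dx\right)^{1/p}$, and $\|f\|_\infty=\operatorname{ess\,sup}_{x\in(0,1)}|f(x)|$. For $u:[0,\infty)\times[0,1]\to\mathbb R$ write $u[t]=u(t,\cdot)$. For sets $A$ with boundary points, $C^1(A)$ means continuously differentiable up to the boundary, and derivatives at boundary points are one-sided. Let $h(s)=1$ for $s<0$ and $h(s)=0$ for $s\ge 0$. Theorem 2.1. Let $\rho_s>0$ be a constant, $\rho_0\in C^1([0,1];(0,\infty))$, $b\in C^1([0,\infty))$ and $v\in C^1([0,\infty)\times[0,1];(0,\infty))$ satisfy the compatibility conditions $$\rho_s e^{b(0)}=\rho_0(0),\qquad \frac{\partial v}{\partial x}(0,0)=-\dot b(0)-v(0,0)\frac{\rho_0'(0)}{\rho_0(0)}.$$ Consider the initial-boundary value problem $$\frac{\partial\rho}{\partial t}(t,x)+v(t,x)\frac{\partial\rho}{\partial x}(t,x)+\rho(t,x)\frac{\partial v}{\partial x}(t,x)=0\quad (t\ge0,\ x\in[0,1]),\qquad (2.1)$$ $$\rho(t,0)=\rho_s e^{b(t)}\quad(t\ge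 0),\qquad (2.2)$$ $$\rho(0,x)=\rho_0(x)\quad (x\in(0,1]).\qquad (2.3)$$ There is at most one $\rho\in C^1([0,\infty)\times[0,1];(0,\infty))$ satisfying (2.1), (2.2), (2.3), and if $\frac{\partial v}{\partial x}\in C^1([0,\infty)\times[0,1])$, then such a $\rho$ exists. Moreover, with $$v_{\min}(t)=\min_{[0,t]\times[0,1]}v,\qquad v_{\max}(t)=\max_{[0,t]\times[0,1]}\frac{\partial v}{\partial x},\qquad I(t)=\left[\max\left(0,t-\tfrac1{v_{\min}(t)}\right),\,t\right],$$ every such solution $\rho$ satisfies, for all $t\ge0$, $p\in(1,\infty)$ and $\mu>0$ with $\mu>-p^{-1}v_{\max}(t)-v_{\min}(t)$, the estimates $$\begin{aligned}\left\|\ln\frac{\rho[t]}{\rho_s}\right\|_p\le{}& e^{p^{-1}v_{\max}(t)t}\,h\!\left(t-\tfrac1{v_{\min}(t)}\right)\left\|\ln\frac{\rho_0}{\rho_s}\right\|_p\\&+\frac1{v_{\min}(t)}\exp\left(1+\frac{\mu+p^{-1}v_{\max}(t)}{v_{\min}(t)}\right)\max_{s\in I(t)}\left(\left\|\frac{\partial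 v}{\partial x}[s]\right\|_p e^{-\mu(t-s)}\right)\\&+\left(v_{\min}(t)\,\frac{\exp\left(\frac{p\mu}{v_{\min}(t)}\right)-1}{p\mu}\right)^{1/p}\max_{s\in I(t)}\left(|b(s)|e^{-\mu(t-s)}\right),\end{aligned}\qquad(2.4)$$ $$\begin{aligned}\max_{0\le x\le1}\left|\ln\frac{\rho(t,x)}{\rho_s}\right|\le{}& h\!\left(t-\tfrac1{v_{\min}(t)}\right)\max_{0\le x\le1}\left|\ln\frac{\rho_0(x)}{\rho_s}\right|\\&+\frac1{v_{\min}(t)}\exp\left(1+\frac{\mu}{v_{\min}(t)}\right)\max_{s\in I(t)}\left(\left\|\frac{\partial v}{\partial x}[s]\right\|_\infty e^{-\mu(t-s)}\right)\\&+\exp\left(\frac{\mu}{v_{\min}(t)}\right)\max_{s\in I(t)}\left(|b(s)|e^{-\mu(t-s)}\right).\end{aligned}\qquad(2.5)$$ -/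

import Mathlib

namespace ContinuityEq

noncomputable section

open Set MeasureTheory

/-- The space-time domain `[0, ∞) × [0, 1]`. -/
def domain : Set (ℝ × ℝ) := Ici 0 ×ˢ Icc 0 1

/-- Time derivative `∂u/∂t (t, x)` of a function on `[0, ∞) × [0, 1]` (one-sided at `t = 0`). -/
def timeDeriv (u : ℝ → ℝ → ℝ) (t x : ℝ) : ℝ := derivWithin (fun s => u s x) (Ici 0) t

/-- Space derivative `∂u/∂x (t, x)` of a function on `[0, ∞) × [0, 1]`
(one-sided at `x = 0` and `x = 1`). -/
def spaceDeriv (u : ℝ → ℝ → ℝ) (t x : ℝ) : ℝ := derivWithin (fun y => u t y) (Icc 0 1) x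

/-- `u ∈ C¹([0, ∞) × [0, 1])`. The domain is closed and convex with non-empty interior, so this
says that `u` is continuous there, and its first derivatives exist and are continuous up to
the boundary. Values of `u` off the domain do not matter. -/
def IsC1 (u : ℝ → ℝ → ℝ) : Prop := ContDiffOn ℝ 1 (fun q : ℝ × ℝ => u q.1 q.2) domain

/-- `u ∈ C¹([0, ∞) × [0, 1]; (0, ∞))`. -/
def IsPosC1 (u : ℝ → ℝ → ℝ) : Prop :=
  IsC1 u ∧ ∀ t x : ℝ, 0 ≤ t → x ∈ Icc (0 : ℝ) 1 → 0 < u t x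

/-- `ρ` is a positive `C¹` solution of the initial-boundary value problem for the continuity
equation with velocity `v`, boundary value `ρs * exp (b t)` and initial profile `ρ0`. -/
structure IsSolution (ρs : ℝ) (ρ0 b : ℝ → ℝ) (v ρ : ℝ → ℝ → ℝ) : Prop where
  posC1 : IsPosC1 ρ
  pde : ∀ t x : ℝ, 0 ≤ t → x ∈ Icc (0 : ℝ) 1 →
    timeDeriv ρ t x + v t x * spaceDeriv ρ t x + ρ t x * spaceDeriv v t x = 0
  boundary : ∀ t : ℝ, 0 ≤ t → ρ t 0 = ρs * Real.exp (b t)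
  initial : ∀ x ∈ Ioc (0 : ℝ) 1, ρ 0 x = ρ0 x

/-- The norm `(∫₀¹ |f(x)|^p dx)^(1/p)`. -/
def normLp (p : ℝ) (f : ℝ → ℝ) : ℝ := (∫ x in (0 : ℝ)..1, |f x| ^ p) ^ (1 / p)

/-- The norm of `L^∞(0, 1)`, i.e. the essential supremum of `|f|` over `(0, 1)`. -/
def normLinfty (f : ℝ → ℝ) : ℝ := (eLpNorm f ⊤ (volume.restrict (Ioo (0 : ℝ) 1))).toReal

/-- The maximum of `f` over `[a, c]`; only used for `a ≤ c` and `f` continuous on `[a, c]`, where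
the supremum is attained. -/
def maxOn (a c : ℝ) (f : ℝ → ℝ) : ℝ := sSup (f '' Icc a c)

/-- The minimum of `v` over `[0, t] × [0, 1]`. -/
def vmin (v : ℝ → ℝ → ℝ) (t : ℝ) : ℝ :=
  sInf ((fun q : ℝ × ℝ => v q.1 q.2) '' (Icc 0 t ×ˢ Icc 0 1))

/-- The maximum of the derivative `∂v/∂x` over `[0, t] × [0, 1]`. -/
def vmax (v : ℝ → ℝ → ℝ) (t : ℝ) : ℝ :=
  sSup ((fun q : ℝ × ℝ => spaceDeriv v q.1 q.2) '' (Icc 0 t ×ˢ Icc 0 1))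

/-- The step function equal to `1` on `(-∞, 0)` and to `0` on `[0, ∞)`. -/
def stepH (s : ℝ) : ℝ := if s < 0 then 1 else 0

/-- The maximum of `g(s) exp(-μ (t - s))` over the memory window
`max(0, t - 1 / v_min(t)) ≤ s ≤ t`. -/
def memoryMax (v : ℝ → ℝ → ℝ) (t μ : ℝ) (g : ℝ → ℝ) : ℝ :=
  maxOn (max 0 (t - 1 / vmin v t)) t (fun s => g s * Real.exp (-μ * (t - s)))

/-- The `L^p` stability estimate at time `t`. -/
def LpEstimate (ρs : ℝ) (ρ0 b : ℝ → ℝ) (v ρ : ℝ → ℝ → ℝ) (t p μ : ℝ) : Prop :=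
  normLp p (fun x => Real.log (ρ t x / ρs)) ≤
    Real.exp (p⁻¹ * vmax v t * t) * stepH (t - 1 / vmin v t) *
        normLp p (fun x => Real.log (ρ0 x / ρs))
    + 1 / vmin v t * Real.exp (1 + (μ + p⁻¹ * vmax v t) / vmin v t) *
        memoryMax v t μ (fun s => normLp p (spaceDeriv v s))
    + (vmin v t * ((Real.exp (p * μ / vmin v t) - 1) / (p * μ))) ^ (1 / p) *
        memoryMax v t μ (fun s => |b s|)

/-- The sup-norm stability estimate at time `t`. -/
def SupEstimate (ρs : ℝ) (ρ0 b : ℝ → ℝ) (v ρ : ℝ → ℝ → ℝ) (t μ : ℝ) : Prop :=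
  maxOn 0 1 (fun x => |Real.log (ρ t x / ρs)|) ≤
    stepH (t - 1 / vmin v t) * maxOn 0 1 (fun x => |Real.log (ρ0 x / ρs)|)
    + 1 / vmin v t * Real.exp (1 + μ / vmin v t) *
        memoryMax v t μ (fun s => normLinfty (spaceDeriv v s))
    + Real.exp (μ / vmin v t) * memoryMax v t μ (fun s => |b s|)

end

end ContinuityEq

open ContinuityEq

namespace ContinuityEq

noncomputable section

open Set MeasureTheory Filter Topology
open scoped ENNReal

/-! The logarithm u = ln(ρ/ρs) turns the continuity equation into the transport equation u_t + v u_x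
= -v_x, so along a characteristic x' = v(t, x) the derivative of u is -v_x
(`IsPosExtension.eq_sub_integral`). Since v > 0, characteristics move to the right: traced backwards
from a point of the domain, each one either is still in [0, 1] at time 0 or meets x = 0 before that.
So u is an initial or boundary value minus an integral of v_x, which gives uniqueness. To have a
global flow, v is first extended to a positive bounded field on the plane
(`IsPosC1.exists_velocity`).

A characteristic needs at most time 1/v_min to cross [0, 1]. Hence the initial profile matters only
for t < 1/v_min, and the boundary data and the source matter only on the memory window
(`IsPosExtension.exists_abs_le`). Suprema give the sup-norm estimate. For the L^p estimate,
Minkowski's integral inequality moves the norm inside the time integral, and the change of variables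
by the flow costs a factor exp(v_max (t - s)) before the p-th root
(`IsPosExtension.lintegral_flow_le`).

For existence, label a characteristic by its position ζ at time 0, negative if it enters the domain
later. The solution has the form Q(ζ) - H(t, ζ), where H integrates v_x along the trajectory. The
one-variable function Q is read off at x = 0 from boundary values B: these are b for t ≥ 0, and for
t ≤ 0 the values that would have produced the initial profile. The two compatibility conditions say
exactly that B is C¹ at 0 (`exists_contDiff_glue`), and the inverse function theorem makes the
crossing time a C¹ function of the label (`contDiffAt_invFun`). -/

/-- `F` is a time-dependent velocity field on the line, continuous together with its space
derivative `F'`, both bounded on bounded time intervals. -/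
structure IsVelocity (F F' : ℝ → ℝ → ℝ) : Prop where
  cont : Continuous (Function.uncurry F)
  cont' : Continuous (Function.uncurry F')
  hasDerivAt : ∀ t x, HasDerivAt (F t) (F' t x) x
  bound : ∀ N : ℝ, ∃ C : NNReal, ∀ t x, |t| ≤ N → |F t x| ≤ C ∧ |F' t x| ≤ C

/-! ### Trajectories of a velocity field on the line -/

/-- The mean of `F' r` over the segment from `a` to `b`. -/
def meanSlope (F' : ℝ → ℝ → ℝ) (r a b : ℝ) : ℝ := ∫ θ in (0 : ℝ)..1, F' r (a + θ * (b - a))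

theorem meanSlope_self (F' : ℝ → ℝ → ℝ) (r a : ℝ) : meanSlope F' r a a = F' r a := by
  simp [meanSlope]

theorem continuous_meanSlope {F' : ℝ → ℝ → ℝ} (h : Continuous (Function.uncurry F'))
    {X : Type*} [TopologicalSpace X] {r a b : X → ℝ} (hr : Continuous r) (ha : Continuous a)
    (hb : Continuous b) : Continuous fun x => meanSlope F' (r x) (a x) (b x) := by
  have h1 : Continuous fun q : ℝ × ℝ × ℝ => meanSlope F' q.1 q.2.1 q.2.2 := by
    unfold meanSlope
    apply intervalIntegral.continuous_parametric_intervalIntegral_of_continuous'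
    exact h.comp (f := fun q : (ℝ × ℝ × ℝ) × ℝ => (q.1.1, q.1.2.1 + q.2 * (q.1.2.2 - q.1.2.1)))
      (by fun_prop)
  exact h1.comp (hr.prodMk (ha.prodMk hb))

namespace IsVelocity

variable {F F' : ℝ → ℝ → ℝ}

theorem continuous_deriv_apply (h : IsVelocity F F') (t : ℝ) : Continuous (F' t) :=
  h.cont'.comp (Continuous.prodMk_right t)

/-- Unlike the slope at an intermediate point, the averaged slope depends continuously on both
endpoints, so it can serve as the coefficient of a linear ODE. -/
theorem sub_eq_mul_meanSlope (h : IsVelocity F F') (r a b : ℝ) :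
    F r b - F r a = (b - a) * meanSlope F' r a b := by
  have hd : ∀ θ : ℝ, HasDerivAt (fun θ => F r (a + θ * (b - a)))
      (F' r (a + θ * (b - a)) * (b - a)) θ := fun θ => by
    have h2 : HasDerivAt (fun θ : ℝ => a + θ * (b - a)) (b - a) θ := by
      simpa using ((hasDerivAt_id θ).mul_const (b - a)).const_add a
    exact (h.hasDerivAt r _).comp θ h2
  have hc := h.continuous_deriv_apply r
  have := intervalIntegral.integral_eq_sub_of_hasDerivAt (a := 0) (b := 1) (fun θ _ => hd θ)
    (Continuous.intervalIntegrable (by fun_prop) _ _)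
  rw [intervalIntegral.integral_mul_const] at this
  simp only [one_mul, zero_mul, add_zero, add_sub_cancel] at this
  rw [← this, meanSlope, mul_comm]

/-- Two trajectories differ by an exponential factor. -/
theorem sub_eq_mul_exp (h : IsVelocity F F') {α β : ℝ → ℝ}
    (hα : ∀ s, HasDerivAt α (F s (α s)) s) (hβ : ∀ s, HasDerivAt β (F s (β s)) s) (t s : ℝ) :
    β s - α s = (β t - α t) * Real.exp (∫ r in t..s, meanSlope F' r (α r) (β r)) := by
  have cα : Continuous α := continuous_iff_continuousAt.2 fun s => (hα s).continuousAt
  have cβ : Continuous β := continuous_iff_continuousAt.2 fun s => (hβ s).continuousAt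
  have cA : Continuous fun r => meanSlope F' r (α r) (β r) :=
    continuous_meanSlope h.cont' continuous_id cα cβ
  have hI : ∀ s, HasDerivAt (fun s => ∫ r in t..s, meanSlope F' r (α r) (β r))
      (meanSlope F' s (α s) (β s)) s := fun s =>
    intervalIntegral.integral_hasDerivAt_right (cA.intervalIntegrable _ _)
      cA.aestronglyMeasurable.stronglyMeasurableAtFilter cA.continuousAt
  -- The difference β - α solves a linear ODE with the mean slope as coefficient; the exponential is
  -- its integrating factor.
  have hd : ∀ s, HasDerivAt (fun s => (β s - α s) *
      Real.exp (-∫ r in t..s, meanSlope F' r (α r) (β r))) 0 s := fun s => by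
    refine (((hβ s).sub (hα s)).mul (hI s).neg.exp).congr_deriv ?_
    rw [h.sub_eq_mul_meanSlope]
    simp only [Pi.sub_apply]
    ring
  have := is_const_of_deriv_eq_zero (fun s => (hd s).differentiableAt) (fun s => (hd s).deriv) s t
  simp only [intervalIntegral.integral_same, neg_zero, Real.exp_zero, mul_one] at this
  rw [← this, mul_assoc, ← Real.exp_add, neg_add_cancel, Real.exp_zero, mul_one]

theorem lipschitz (h : IsVelocity F F') (N : ℝ) :
    ∃ C : NNReal, ∀ t, |t| ≤ N → (∀ x, |F t x| ≤ C) ∧ LipschitzWith C (F t) := by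
  obtain ⟨C, hC⟩ := h.bound N
  refine ⟨C, fun t ht => ⟨fun x => (hC t x ht).1, ?_⟩⟩
  refine lipschitzWith_of_nnnorm_deriv_le (fun x => (h.hasDerivAt t x).differentiableAt) fun x => ?_
  rw [(h.hasDerivAt t x).deriv, ← NNReal.coe_le_coe]
  exact (hC t x ht).2

theorem exists_trajectory_Ioo (h : IsVelocity F F') {N t x : ℝ} (ht : |t| < N) :
    ∃ α : ℝ → ℝ, α t = x ∧ ∀ s ∈ Ioo (-N) N, HasDerivAt α (F s (α s)) s := by
  obtain ⟨C, hC⟩ := h.lipschitz N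
  have ht' : t ∈ Icc (-N) N := abs_le.1 ht.le
  have hN : 0 ≤ N := (abs_nonneg t).trans ht.le
  -- The speed is at most `C` and the time interval has length 2N, so no trajectory leaves the ball
  -- of radius C · 2N; the bounds are global in space, so this radius is admissible.
  have hp : IsPicardLindelof F (tmin := -N) (tmax := N) ⟨t, ht'⟩ x (C * ⟨2 * N, by positivity⟩) 0 C C := by
    constructor
    · exact fun s hs => (hC s (abs_le.2 hs)).2.lipschitzOnWith
    · exact fun y _ => (h.cont.comp (Continuous.prodMk_left y)).continuousOn
    · exact fun s hs y _ => (hC s (abs_le.2 hs)).1 y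
    · change (C : ℝ) * max (N - t) (t - -N) ≤ C * (2 * N) - 0
      rw [sub_zero]
      refine mul_le_mul_of_nonneg_left (max_le ?_ ?_) C.2 <;> linarith [ht'.1, ht'.2]
  obtain ⟨α, h1, h2⟩ := hp.exists_eq_forall_mem_Icc_hasDerivWithinAt₀
  exact ⟨α, h1, fun s hs => (h2 s (Ioo_subset_Icc_self hs)).hasDerivAt (Icc_mem_nhds hs.1 hs.2)⟩

theorem exists_trajectory (h : IsVelocity F F') (t x : ℝ) :
    ∃ α : ℝ → ℝ, α t = x ∧ ∀ s, HasDerivAt α (F s (α s)) s := by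
  have key : ∀ n : ℕ, ∃ α : ℝ → ℝ, α t = x ∧
      ∀ s ∈ Ioo (-(|t| + 1 + n)) (|t| + 1 + n), HasDerivAt α (F s (α s)) s := fun n =>
    h.exists_trajectory_Ioo (by linarith [Nat.cast_nonneg (α := ℝ) n])
  choose α hα hd using key
  have hle : ∀ m n : ℕ, m ≤ n → ∀ s ∈ Ioo (-(|t| + 1 + m)) (|t| + 1 + m), α m s = α n s := by
    intro m n hmn
    have hmn' : (m : ℝ) ≤ n := by exact_mod_cast hmn
    obtain ⟨C, hC⟩ := h.lipschitz (|t| + 1 + m)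
    refine ODE_solution_unique_of_mem_Ioo (v := F) (s := fun _ => univ) (K := C) (t₀ := t)
      (fun s hs => (hC s (abs_le.2 ⟨hs.1.le, hs.2.le⟩)).2.lipschitzOnWith) ?_
      (fun s hs => ⟨hd m s hs, mem_univ _⟩)
      (fun s hs => ⟨hd n s ⟨by linarith [hs.1], by linarith [hs.2]⟩, mem_univ _⟩)
      ((hα m).trans (hα n).symm)
    have := Nat.cast_nonneg (α := ℝ) m
    exact abs_lt.1 (by linarith)
  have heq : ∀ m n : ℕ, ∀ s, |s| < |t| + 1 + m → |s| < |t| + 1 + n → α m s = α n s := by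
    intro m n s hm hn
    rcases le_total m n with hmn | hmn
    · exact hle m n hmn s (abs_lt.1 hm)
    · exact (hle n m hmn s (abs_lt.1 hn)).symm
  have hb : ∀ s : ℝ, |s| < |t| + 1 + ⌈|s|⌉₊ := fun s => by
    linarith [Nat.le_ceil |s|, abs_nonneg t]
  -- At time `s`, use the local trajectory whose interval is sure to contain `s`; by uniqueness the
  -- choice of index does not matter.
  refine ⟨fun s => α ⌈|s|⌉₊ s, hα _, fun s => ?_⟩
  refine (hd _ s (abs_lt.1 (hb s))).congr_of_eventuallyEq ?_
  filter_upwards [(continuous_abs.tendsto s).eventually (gt_mem_nhds (hb s))] with r hr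
  exact heq _ _ r (hb r) hr

/-- The value at time `s` of the trajectory that is at `x` at time `t`. -/
def flow (h : IsVelocity F F') (t x s : ℝ) : ℝ := (h.exists_trajectory t x).choose s

end IsVelocity

/-! ### Calculus lemmas for functions of two variables -/

/-- A function with continuous partial derivatives is continuously differentiable. -/
theorem hasFDerivAt_of_partials {f f₁ f₂ : ℝ → ℝ → ℝ}
    (h₁ : ∀ t x, HasDerivAt (fun s => f s x) (f₁ t x) t)
    (h₂ : ∀ t x, HasDerivAt (f t) (f₂ t x) x)
    (c₁ : Continuous (Function.uncurry f₁)) (c₂ : Continuous (Function.uncurry f₂)) (q : ℝ × ℝ) :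
    HasFDerivAt (Function.uncurry f)
      (((ContinuousLinearMap.toSpanSingleton ℝ (f₁ q.1 q.2))).coprod
        (ContinuousLinearMap.toSpanSingleton ℝ (f₂ q.1 q.2))) q := by
  have e : Continuous fun c : ℝ => ContinuousLinearMap.toSpanSingleton ℝ c :=
    LinearMap.continuous_of_finiteDimensional
      (ContinuousLinearMap.toSpanSingletonLE ℝ ℝ ℝ).toLinearMap
  exact (hasStrictFDerivAt_uncurry_coprod (𝕜 := ℝ) (f := f)
    (f₁ := fun t x => ContinuousLinearMap.toSpanSingleton ℝ (f₁ t x))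
    (f₂ := fun t x => ContinuousLinearMap.toSpanSingleton ℝ (f₂ t x))
    (Eventually.of_forall fun v => (h₁ v.1 v.2).hasFDerivAt)
    (Eventually.of_forall fun v => (h₂ v.1 v.2).hasFDerivAt)
    (e.comp c₁).continuousAt (e.comp c₂).continuousAt).hasFDerivAt

theorem contDiff_of_partials {f f₁ f₂ : ℝ → ℝ → ℝ}
    (h₁ : ∀ t x, HasDerivAt (fun s => f s x) (f₁ t x) t)
    (h₂ : ∀ t x, HasDerivAt (f t) (f₂ t x) x)
    (c₁ : Continuous (Function.uncurry f₁)) (c₂ : Continuous (Function.uncurry f₂)) :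
    ContDiff ℝ 1 (Function.uncurry f) := by
  have e : Continuous fun c : ℝ => ContinuousLinearMap.toSpanSingleton ℝ c :=
    LinearMap.continuous_of_finiteDimensional
      (ContinuousLinearMap.toSpanSingletonLE ℝ ℝ ℝ).toLinearMap
  refine contDiff_one_iff_hasFDerivAt.2 ⟨_, ?_, hasFDerivAt_of_partials h₁ h₂ c₁ c₂⟩
  simp_rw [← ContinuousLinearMap.comp_fst_add_comp_snd]
  exact ((e.comp c₁).clm_comp continuous_const).add ((e.comp c₂).clm_comp continuous_const)

/-- Where `f` vanishes, the difference quotient of the product is that of `f` times `e`, so `e` need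
only be continuous. This is what allows the flow to be differentiated through its difference
formula. -/
theorem hasDerivAt_mul_of_eq_zero {f e : ℝ → ℝ} {f' x : ℝ} (hf : HasDerivAt f f' x) (h0 : f x = 0)
    (he : ContinuousAt e x) : HasDerivAt (fun y => f y * e y) (f' * e x) x := by
  rw [hasDerivAt_iff_tendsto_slope] at hf ⊢
  refine (hf.mul (he.tendsto.mono_left nhdsWithin_le_nhds)).congr fun y => ?_
  simp only [slope_def_field, h0]
  ring

theorem continuous_primitive_two {X : Type*} [TopologicalSpace X] {f : X → ℝ → ℝ}
    (hf : Continuous (Function.uncurry f)) {a b : X → ℝ} (ha : Continuous a) (hb : Continuous b) :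
    Continuous fun x => ∫ r in a x..b x, f x r := by
  have : ∀ x, ∫ r in a x..b x, f x r = (∫ r in (0 : ℝ)..b x, f x r) - ∫ r in (0 : ℝ)..a x, f x r :=
    fun x => by
      have hc : Continuous (f x) := hf.comp (Continuous.prodMk_right x)
      rw [intervalIntegral.integral_interval_sub_left] <;> exact hc.intervalIntegrable _ _
  simp_rw [this]
  exact (intervalIntegral.continuous_parametric_intervalIntegral_of_continuous hf hb).sub
    (intervalIntegral.continuous_parametric_intervalIntegral_of_continuous hf ha)

/-! ### The flow and its derivatives -/

namespace IsVelocity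

variable {F F' : ℝ → ℝ → ℝ}

theorem flow_self (h : IsVelocity F F') (t x : ℝ) : h.flow t x t = x :=
  (h.exists_trajectory t x).choose_spec.1

theorem hasDerivAt_flow (h : IsVelocity F F') (t x s : ℝ) :
    HasDerivAt (h.flow t x) (F s (h.flow t x s)) s :=
  (h.exists_trajectory t x).choose_spec.2 s

theorem continuous_flow_time (h : IsVelocity F F') (t x : ℝ) : Continuous (h.flow t x) :=
  continuous_iff_continuousAt.2 fun s => (h.hasDerivAt_flow t x s).continuousAt

/-- All regularity of the flow comes from this comparison: the gap at time `τ`, which is explicit,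
is multiplied by a factor that stays controlled. -/
theorem flow_sub (h : IsVelocity F F') (t x τ y s : ℝ) :
    h.flow τ y s - h.flow t x s = (y - h.flow t x τ) *
      Real.exp (∫ r in τ..s, meanSlope F' r (h.flow t x r) (h.flow τ y r)) := by
  rw [h.sub_eq_mul_exp (h.hasDerivAt_flow t x) (h.hasDerivAt_flow τ y) τ s, h.flow_self]

theorem flow_flow (h : IsVelocity F F') (t x r s : ℝ) :
    h.flow r (h.flow t x r) s = h.flow t x s := by
  have := h.flow_sub t x r (h.flow t x r) s
  rw [sub_self, zero_mul] at this
  linarith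

theorem strictMono_flow (h : IsVelocity F F') (t s : ℝ) : StrictMono fun x => h.flow t x s := by
  intro x y hxy
  have := h.flow_sub t x t y s
  rw [h.flow_self] at this
  have h2 := mul_pos (sub_pos.2 hxy)
    (Real.exp_pos (∫ r in t..s, meanSlope F' r (h.flow t x r) (h.flow t y r)))
  simp only
  linarith

/-- Against the fixed trajectory through (t₀, x₀), the gap at the starting time tends to 0, and up
to the final time it grows at most by the factor exp(2NC). -/
theorem continuous_flow (h : IsVelocity F F') :
    Continuous fun q : ℝ × ℝ × ℝ => h.flow q.1 q.2.1 q.2.2 := by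
  rw [continuous_iff_continuousAt]
  rintro ⟨t₀, x₀, s₀⟩
  set N := max |t₀| |s₀| + 1
  obtain ⟨C, hC⟩ := h.bound N
  have hN : 0 ≤ N := by positivity
  have h1 : Tendsto (fun q : ℝ × ℝ × ℝ => |q.2.1 - h.flow t₀ x₀ q.1| * Real.exp (C * (2 * N)))
      (𝓝 (t₀, x₀, s₀)) (𝓝 0) := by
    have := h.continuous_flow_time t₀ x₀
    have h2 : Continuous fun q : ℝ × ℝ × ℝ =>
      |q.2.1 - h.flow t₀ x₀ q.1| * Real.exp (C * (2 * N)) := by fun_prop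
    simpa [h.flow_self] using h2.tendsto (t₀, x₀, s₀)
  have h3 : Tendsto (fun q : ℝ × ℝ × ℝ => h.flow q.1 q.2.1 q.2.2 - h.flow t₀ x₀ q.2.2)
      (𝓝 (t₀, x₀, s₀)) (𝓝 0) := by
    refine squeeze_zero_norm' ?_ h1
    have e1 : ∀ᶠ q : ℝ × ℝ × ℝ in 𝓝 (t₀, x₀, s₀), |q.1| < N :=
      (continuous_fst.abs.tendsto _).eventually
        (gt_mem_nhds (lt_of_le_of_lt (le_max_left _ _) (lt_add_one _)))
    have e2 : ∀ᶠ q : ℝ × ℝ × ℝ in 𝓝 (t₀, x₀, s₀), |q.2.2| < N :=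
      (continuous_snd.snd.abs.tendsto _).eventually
        (gt_mem_nhds (lt_of_le_of_lt (le_max_right _ _) (lt_add_one _)))
    filter_upwards [e1, e2] with q hq1 hq2
    rw [h.flow_sub, norm_mul, Real.norm_eq_abs, Real.norm_eq_abs, Real.abs_exp]
    gcongr
    refine (le_abs_self _).trans ?_
    rw [← Real.norm_eq_abs]
    have hq1' := abs_lt.1 hq1
    have hq2' := abs_lt.1 hq2
    refine (intervalIntegral.norm_integral_le_of_norm_le_const (C := C) fun r hr => ?_).trans ?_
    · have hr' : |r| ≤ N := by
        rw [abs_le]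
        rcases mem_uIoc.1 hr with hr | hr <;> constructor <;> linarith [hr.1, hr.2]
      refine (intervalIntegral.norm_integral_le_of_norm_le_const (C := C) fun θ _ =>
        (hC r _ hr').2).trans ?_
      simp
    · have : |q.2.2 - q.1| ≤ 2 * N := by
        rw [abs_le]; constructor <;> linarith
      gcongr
  have h4 := h3.add ((h.continuous_flow_time t₀ x₀).comp continuous_snd.snd).continuousAt.tendsto
  simp only [Function.comp_def, sub_add_cancel, zero_add] at h4
  exact h4

theorem continuous_flow_comp (h : IsVelocity F F') {X : Type*} [TopologicalSpace X] {t x s : X → ℝ}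
    (ht : Continuous t) (hx : Continuous x) (hs : Continuous s) :
    Continuous fun a => h.flow (t a) (x a) (s a) :=
  h.continuous_flow.comp (ht.prodMk (hx.prodMk hs))

/-- The derivative of the flow map from time `t` to time `s` at the point `x`. -/
def flowDeriv (h : IsVelocity F F') (t x s : ℝ) : ℝ :=
  Real.exp (∫ r in t..s, F' r (h.flow t x r))

theorem flowDeriv_pos (h : IsVelocity F F') (t x s : ℝ) : 0 < h.flowDeriv t x s := Real.exp_pos _

theorem continuous_flowDeriv (h : IsVelocity F F') :
    Continuous fun q : ℝ × ℝ × ℝ => h.flowDeriv q.1 q.2.1 q.2.2 := by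
  refine Real.continuous_exp.comp (continuous_primitive_two ?_ continuous_fst continuous_snd.snd)
  refine h.cont'.comp (f := fun p : (ℝ × ℝ × ℝ) × ℝ => (p.2, h.flow p.1.1 p.1.2.1 p.2))
    (continuous_snd.prodMk (h.continuous_flow_comp ?_ ?_ ?_)) <;> fun_prop

theorem hasDerivAt_flow_space (h : IsVelocity F F') (t x s : ℝ) :
    HasDerivAt (fun y => h.flow t y s) (h.flowDeriv t x s) x := by
  have hc : Continuous fun y =>
      Real.exp (∫ r in t..s, meanSlope F' r (h.flow t x r) (h.flow t y r)) := by
    refine Real.continuous_exp.comp (continuous_primitive_two ?_ continuous_const continuous_const)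
    exact continuous_meanSlope h.cont' continuous_snd
      (h.continuous_flow_comp continuous_const continuous_const continuous_snd)
      (h.continuous_flow_comp continuous_const continuous_fst continuous_snd)
  have := (hasDerivAt_mul_of_eq_zero ((hasDerivAt_id x).sub_const x) (sub_self x)
    hc.continuousAt).const_add (h.flow t x s)
  simp only [meanSlope_self, one_mul] at this
  refine this.congr_of_eventuallyEq (Eventually.of_forall fun y => ?_)
  have h2 := h.flow_sub t x t y s
  rw [h.flow_self] at h2
  simp only [id]
  linarith

/-- When the starting time moves to `τ`, the gap to the original trajectory is x - flow t x τ, which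
vanishes at τ = t with derivative -F t x. Together with the space derivative this says that the flow
is constant along characteristics. -/
theorem hasDerivAt_flow_start (h : IsVelocity F F') (t x s : ℝ) :
    HasDerivAt (fun τ => h.flow τ x s) (-F t x * h.flowDeriv t x s) t := by
  have hc : Continuous fun τ =>
      Real.exp (∫ r in τ..s, meanSlope F' r (h.flow t x r) (h.flow τ x r)) := by
    refine Real.continuous_exp.comp (continuous_primitive_two ?_ continuous_id continuous_const)
    exact continuous_meanSlope h.cont' continuous_snd
      (h.continuous_flow_comp continuous_const continuous_const continuous_snd)
      (h.continuous_flow_comp continuous_fst continuous_const continuous_snd)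
  have h0 : HasDerivAt (fun τ => x - h.flow t x τ) (-F t x) t := by
    simpa [h.flow_self] using (h.hasDerivAt_flow t x t).const_sub x
  have := (hasDerivAt_mul_of_eq_zero h0 (by simp [h.flow_self])
    hc.continuousAt).const_add (h.flow t x s)
  simp only [meanSlope_self] at this
  refine this.congr_of_eventuallyEq (Eventually.of_forall fun τ => ?_)
  have h2 := h.flow_sub t x τ x s
  simp only
  linarith

theorem continuous_neg_mul_flowDeriv (h : IsVelocity F F') (s : ℝ) :
    Continuous (Function.uncurry fun t x => -F t x * h.flowDeriv t x s) := by
  have h1 := h.cont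
  have h2 : Continuous fun q : ℝ × ℝ => h.flowDeriv q.1 q.2 s :=
    h.continuous_flowDeriv.comp (f := fun q : ℝ × ℝ => (q.1, q.2, s)) (by fun_prop)
  exact h1.neg.mul h2

theorem contDiff_flow (h : IsVelocity F F') (s : ℝ) :
    ContDiff ℝ 1 (Function.uncurry fun t x => h.flow t x s) :=
  contDiff_of_partials (fun t x => h.hasDerivAt_flow_start t x s)
    (fun t x => h.hasDerivAt_flow_space t x s) (h.continuous_neg_mul_flowDeriv s)
    (h.continuous_flowDeriv.comp (f := fun q : ℝ × ℝ => (q.1, q.2, s)) (by fun_prop))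

end IsVelocity

/-! ### Extension of functions from the domain to the plane -/

/-- The function `f` on `domain`, extended to the plane by composition with the nearest-point
projection. -/
def retract (f : ℝ → ℝ → ℝ) (t x : ℝ) : ℝ := f (max t 0) (max 0 (min 1 x))

theorem retract_mem (t x : ℝ) : (max t 0, max 0 (min 1 x)) ∈ domain :=
  ⟨le_max_right t 0, le_max_left _ _, max_le zero_le_one (min_le_left _ _)⟩

theorem max_min_of_mem {x : ℝ} (hx : x ∈ Icc (0 : ℝ) 1) : max 0 (min 1 x) = x := by
  rw [min_eq_right hx.2, max_eq_right hx.1]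

theorem retract_eq (f : ℝ → ℝ → ℝ) {t x : ℝ} (ht : 0 ≤ t) (hx : x ∈ Icc (0 : ℝ) 1) :
    retract f t x = f t x := by
  rw [retract, max_eq_left ht, max_min_of_mem hx]

theorem continuous_retract {f : ℝ → ℝ → ℝ} (hf : ContinuousOn (Function.uncurry f) domain) :
    Continuous (Function.uncurry (retract f)) :=
  hf.comp_continuous (f := fun q : ℝ × ℝ => (max q.1 0, max 0 (min 1 q.2))) (by fun_prop)
    fun q => retract_mem q.1 q.2

/-- Extension to the plane of a function `f` on `domain` with space derivative `f₁`. -/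
def extend (f f₁ : ℝ → ℝ → ℝ) (t x : ℝ) : ℝ := retract f t 0 + ∫ y in (0 : ℝ)..x, retract f₁ t y

theorem continuous_extend {f f₁ : ℝ → ℝ → ℝ} (hf : ContinuousOn (Function.uncurry f) domain)
    (hf₁ : ContinuousOn (Function.uncurry f₁) domain) :
    Continuous (Function.uncurry (extend f f₁)) := by
  refine ((continuous_retract hf).comp (f := fun q : ℝ × ℝ => (q.1, (0 : ℝ)))
    (by fun_prop)).add ?_
  exact intervalIntegral.continuous_parametric_intervalIntegral_of_continuous
    (f := fun (q : ℝ × ℝ) y => retract f₁ q.1 y)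
    ((continuous_retract hf₁).comp (f := fun p : (ℝ × ℝ) × ℝ => (p.1.1, p.2)) (by fun_prop))
    continuous_snd

theorem hasDerivAt_extend (f : ℝ → ℝ → ℝ) {f₁ : ℝ → ℝ → ℝ}
    (hf₁ : ContinuousOn (Function.uncurry f₁) domain) (t x : ℝ) :
    HasDerivAt (extend f f₁ t) (retract f₁ t x) x := by
  have hc : Continuous (retract f₁ t) :=
    (continuous_retract hf₁).comp (Continuous.prodMk_right t)
  exact (intervalIntegral.integral_hasDerivAt_right (hc.intervalIntegrable _ _)
    hc.aestronglyMeasurable.stronglyMeasurableAtFilter hc.continuousAt).const_add _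

theorem extend_eq {f f₁ : ℝ → ℝ → ℝ} (hf₁ : ContinuousOn (Function.uncurry f₁) domain)
    {t x : ℝ} (ht : 0 ≤ t) (hx : x ∈ Icc (0 : ℝ) 1)
    (hd : ∀ y ∈ Icc (0 : ℝ) 1, HasDerivWithinAt (f t) (f₁ t y) (Icc 0 1) y) :
    extend f f₁ t x = f t x := by
  have hc : Continuous (retract f₁ t) :=
    (continuous_retract hf₁).comp (Continuous.prodMk_right t)
  have hsub : Icc 0 x ⊆ Icc (0 : ℝ) 1 := Icc_subset_Icc_right hx.2
  have := intervalIntegral.integral_eq_sub_of_hasDerivAt_of_le hx.1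
    (fun y hy => ((hd y (hsub hy)).continuousWithinAt.mono hsub)) (f' := retract f₁ t)
    (fun y hy => by
      rw [retract_eq f₁ ht (hsub (Ioo_subset_Icc_self hy))]
      exact (hd y (hsub (Ioo_subset_Icc_self hy))).hasDerivAt
        (Icc_mem_nhds hy.1 (hy.2.trans_le hx.2)))
    (hc.intervalIntegrable _ _)
  rw [extend, this, retract_eq f ht ⟨le_rfl, zero_le_one⟩]
  ring

/-! ### One-sided derivatives of C¹ functions on the domain -/

theorem mem_domain {t x : ℝ} (ht : 0 ≤ t) (hx : x ∈ Icc (0 : ℝ) 1) : (t, x) ∈ domain := ⟨ht, hx⟩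

theorem uniqueDiffOn_domain : UniqueDiffOn ℝ domain :=
  (uniqueDiffOn_Ici 0).prod (uniqueDiffOn_Icc zero_lt_one)

theorem HasFDerivWithinAt.partials {u : ℝ → ℝ → ℝ} {A : ℝ × ℝ →L[ℝ] ℝ} {t x : ℝ}
    (h : HasFDerivWithinAt (fun q : ℝ × ℝ => u q.1 q.2) A domain (t, x)) (ht : 0 ≤ t)
    (hx : x ∈ Icc (0 : ℝ) 1) :
    HasDerivWithinAt (fun s => u s x) (A (1, 0)) (Ici 0) t ∧
      HasDerivWithinAt (u t) (A (0, 1)) (Icc 0 1) x := by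
  constructor
  · exact h.comp_hasDerivWithinAt (f := fun s => (s, x)) t
      ((hasDerivAt_id t).prodMk (hasDerivAt_const t x)).hasDerivWithinAt
      fun s hs => mem_domain hs hx
  · exact h.comp_hasDerivWithinAt (f := fun y => (t, y)) x
      ((hasDerivAt_const x t).prodMk (hasDerivAt_id x)).hasDerivWithinAt
      fun y hy => mem_domain ht hy

theorem timeDeriv_eq {u : ℝ → ℝ → ℝ} {t x d : ℝ} (ht : 0 ≤ t)
    (h : HasDerivWithinAt (fun s => u s x) d (Ici 0) t) : timeDeriv u t x = d :=
  h.derivWithin (uniqueDiffOn_Ici (0 : ℝ) t ht)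

theorem spaceDeriv_eq {u : ℝ → ℝ → ℝ} {t x d : ℝ} (hx : x ∈ Icc (0 : ℝ) 1)
    (h : HasDerivWithinAt (u t) d (Icc 0 1) x) : spaceDeriv u t x = d :=
  h.derivWithin (uniqueDiffOn_Icc zero_lt_one x hx)

namespace IsC1

variable {u : ℝ → ℝ → ℝ}

theorem hasFDerivWithinAt (hu : IsC1 u) {t x : ℝ} (ht : 0 ≤ t) (hx : x ∈ Icc (0 : ℝ) 1) :
    HasFDerivWithinAt (fun q : ℝ × ℝ => u q.1 q.2)
      (fderivWithin ℝ (fun q : ℝ × ℝ => u q.1 q.2) domain (t, x)) domain (t, x) :=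
  (hu.differentiableOn one_ne_zero _ (mem_domain ht hx)).hasFDerivWithinAt

theorem hasDerivWithinAt_space (hu : IsC1 u) {t x : ℝ} (ht : 0 ≤ t) (hx : x ∈ Icc (0 : ℝ) 1) :
    HasDerivWithinAt (u t) (spaceDeriv u t x) (Icc 0 1) x := by
  have := (HasFDerivWithinAt.partials (hu.hasFDerivWithinAt ht hx) ht hx).2
  rwa [spaceDeriv_eq hx this]

theorem fderivWithin_apply (hu : IsC1 u) {t x : ℝ} (ht : 0 ≤ t) (hx : x ∈ Icc (0 : ℝ) 1)
    (a c : ℝ) : fderivWithin ℝ (fun q : ℝ × ℝ => u q.1 q.2) domain (t, x) (a, c) =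
      a * timeDeriv u t x + c * spaceDeriv u t x := by
  have := HasFDerivWithinAt.partials (hu.hasFDerivWithinAt ht hx) ht hx
  rw [timeDeriv_eq ht this.1, spaceDeriv_eq hx this.2]
  have e : ((a, c) : ℝ × ℝ) = a • (1, 0) + c • (0, 1) := by simp
  rw [e, map_add, map_smul, map_smul, smul_eq_mul, smul_eq_mul]

theorem continuousOn_spaceDeriv (hu : IsC1 u) :
    ContinuousOn (Function.uncurry (spaceDeriv u)) domain := by
  have h := hu.continuousOn_fderivWithin uniqueDiffOn_domain le_rfl
  refine (h.clm_apply (continuousOn_const (c := ((0 : ℝ), (1 : ℝ))))).congr fun q hq => ?_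
  have := hu.fderivWithin_apply hq.1 hq.2 0 1
  rw [zero_mul, one_mul, zero_add] at this
  exact this.symm

theorem continuousOn_spaceDeriv_apply (hu : IsC1 u) {t : ℝ} (ht : 0 ≤ t) :
    ContinuousOn (spaceDeriv u t) (Icc 0 1) :=
  hu.continuousOn_spaceDeriv.comp (f := fun y => (t, y)) (by fun_prop)
    fun _ hy => mem_domain ht hy

/-- The derivative of a `C¹` function along a curve in the domain. -/
theorem hasDerivWithinAt_curve (hu : IsC1 u) {γ : ℝ → ℝ} {S : Set ℝ} {s d : ℝ} (hs : s ∈ S)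
    (hS : ∀ r ∈ S, 0 ≤ r ∧ γ r ∈ Icc (0 : ℝ) 1) (hγ : HasDerivAt γ d s) :
    HasDerivWithinAt (fun r => u r (γ r)) (timeDeriv u s (γ s) + d * spaceDeriv u s (γ s)) S s := by
  have h := (hu.hasFDerivWithinAt (hS s hs).1 (hS s hs).2).comp_hasDerivWithinAt
    (f := fun r => (r, γ r)) s ((hasDerivAt_id s).prodMk hγ).hasDerivWithinAt
    (fun r hr => mem_domain (hS r hr).1 (hS r hr).2)
  rw [hu.fderivWithin_apply (hS s hs).1 (hS s hs).2, one_mul] at h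
  exact h

end IsC1

/-! ### Extension of the velocity -/

/-- A positive `C¹` velocity on `domain` extends to a positive velocity field on the plane. -/
theorem IsPosC1.exists_velocity {v : ℝ → ℝ → ℝ} (hv : IsPosC1 v) :
    ∃ F F' : ℝ → ℝ → ℝ, IsVelocity F F' ∧ (∀ t x, 0 < F t x) ∧
      (∀ t x, t ≤ 0 → F t x = F 0 x) ∧ ∀ t x, 0 ≤ t → x ∈ Icc (0 : ℝ) 1 → F t x = v t x ∧ F' t x = spaceDeriv v t x := by
  let χ : ContDiffBump (1 / 2 : ℝ) := ⟨1, 2, one_pos, one_lt_two⟩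
  let l : ℝ → ℝ → ℝ := fun t x => spaceDeriv v t x / v t x
  let lv : ℝ → ℝ → ℝ := fun t x => Real.log (v t x)
  have hpos : ∀ q ∈ domain, 0 < v q.1 q.2 := fun q hq => hv.2 q.1 q.2 hq.1 hq.2
  have hl : ContinuousOn (Function.uncurry l) domain :=
    hv.1.continuousOn_spaceDeriv.div hv.1.continuousOn fun q hq => (hpos q hq).ne'
  have hlv : ContinuousOn (Function.uncurry lv) domain :=
    hv.1.continuousOn.log fun q hq => (hpos q hq).ne'
  let L := extend lv l
  have cL : Continuous (Function.uncurry L) := continuous_extend hlv hl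
  have cχ : Continuous χ := χ.continuous
  have cχ' : Continuous (deriv χ) := (χ.contDiff (n := 1)).continuous_deriv le_rfl
  -- Extending ln v and exponentiating keeps the field positive. The cutoff is 1 near [0, 1], so
  -- nothing changes there, and makes the field equal to 1 for large |x|, hence bounded.
  let F : ℝ → ℝ → ℝ := fun t x => Real.exp (χ x * L t x)
  let F' : ℝ → ℝ → ℝ := fun t x => F t x * (deriv χ x * L t x + χ x * retract l t x)
  have cF : Continuous (Function.uncurry F) :=
    Real.continuous_exp.comp ((cχ.comp continuous_snd).mul cL)
  have cF' : Continuous (Function.uncurry F') :=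
    cF.mul (((cχ'.comp continuous_snd).mul cL).add
      ((cχ.comp continuous_snd).mul (continuous_retract hl)))
  refine ⟨F, F', ⟨cF, cF', fun t x => ?_, fun N => ?_⟩, fun t x => Real.exp_pos _,
    fun t x ht => by simp only [F, L, extend, retract, max_eq_right ht, max_self],
    fun t x ht hx => ?_⟩
  · have h1 : HasDerivAt χ (deriv χ x) x :=
      ((χ.contDiff (n := 1)).differentiable one_ne_zero x).hasDerivAt
    exact (h1.mul (hasDerivAt_extend lv hl t x)).exp
  · have hK : IsCompact (Icc (-N) N ×ˢ Icc (-3 : ℝ) 3) := isCompact_Icc.prod isCompact_Icc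
    obtain ⟨C₁, hC₁⟩ := hK.exists_bound_of_continuousOn cF.continuousOn
    obtain ⟨C₂, hC₂⟩ := hK.exists_bound_of_continuousOn cF'.continuousOn
    refine ⟨(max 1 (max C₁ C₂)).toNNReal, fun t x ht => ?_⟩
    rw [Real.coe_toNNReal _ (zero_le_one.trans (le_max_left _ _))]
    by_cases hx : x ∈ Icc (-3 : ℝ) 3
    · exact ⟨(hC₁ (t, x) ⟨abs_le.1 ht, hx⟩).trans ((le_max_left _ _).trans (le_max_right _ _)),
        (hC₂ (t, x) ⟨abs_le.1 ht, hx⟩).trans ((le_max_right _ _).trans (le_max_right _ _))⟩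
    · have hx' : x ∉ tsupport χ := fun h => hx <| by
        rw [χ.tsupport_eq, Metric.mem_closedBall, Real.dist_eq, abs_le] at h
        have h' : -2 ≤ x - 1 / 2 ∧ x - 1 / 2 ≤ 2 := h
        constructor <;> linarith [h'.1, h'.2]
      have hz := notMem_tsupport_iff_eventuallyEq.1 hx'
      have h0 : χ x = 0 := hz.eq_of_nhds
      have h0' : deriv χ x = 0 := by rw [hz.deriv_eq]; simp
      simp only [F, F', h0, h0', zero_mul, Real.exp_zero, abs_one, add_zero, mul_zero, abs_zero]
      exact ⟨le_max_left _ _, zero_le_one.trans (le_max_left _ _)⟩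
  · have hb : x ∈ Metric.ball (1 / 2 : ℝ) 1 := by
      rw [Metric.mem_ball, Real.dist_eq, abs_lt]
      constructor <;> linarith [hx.1, hx.2]
    have hz := χ.eventuallyEq_one_of_mem_ball hb
    have h1 : χ x = 1 := hz.eq_of_nhds
    have h1' : deriv χ x = 0 := by rw [hz.deriv_eq]; exact deriv_const x 1
    have hL : L t x = Real.log (v t x) := extend_eq hl ht hx fun y hy =>
      (hv.1.hasDerivWithinAt_space ht hy).log (hv.2 t y ht hy).ne'
    have hF : F t x = v t x := by
      simp only [F, h1, one_mul, hL]
      exact Real.exp_log (hv.2 t x ht hx)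
    refine ⟨hF, ?_⟩
    simp only [F', hF, h1, h1', zero_mul, zero_add, one_mul, retract_eq l ht hx, l]
    exact mul_div_cancel₀ _ (hv.2 t x ht hx).ne'

/-- `F`, with space derivative `F'`, is a positive velocity field on the plane extending `v`. -/
structure IsPosExtension (v F F' : ℝ → ℝ → ℝ) : Prop extends IsVelocity F F' where
  pos : ∀ t x, 0 < F t x
  eq_zero_time : ∀ t x, t ≤ 0 → F t x = F 0 x
  eq : ∀ t x, 0 ≤ t → x ∈ Icc (0 : ℝ) 1 → F t x = v t x
  eq' : ∀ t x, 0 ≤ t → x ∈ Icc (0 : ℝ) 1 → F' t x = spaceDeriv v t x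

theorem IsPosC1.exists_isPosExtension {v : ℝ → ℝ → ℝ} (hv : IsPosC1 v) :
    ∃ F F' : ℝ → ℝ → ℝ, IsPosExtension v F F' := by
  obtain ⟨F, F', h, hpos, h0, he⟩ := hv.exists_velocity
  exact ⟨F, F', h, hpos, h0, fun t x ht hx => (he t x ht hx).1, fun t x ht hx => (he t x ht hx).2⟩

/-! ### Extrema and the memory window -/

section Extrema

variable {v : ℝ → ℝ → ℝ} {t : ℝ}

theorem Icc_prod_subset_domain (t : ℝ) : Icc 0 t ×ˢ Icc (0 : ℝ) 1 ⊆ domain :=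
  prod_mono_left Icc_subset_Ici_self

theorem vmin_le (hv : ContinuousOn (fun q : ℝ × ℝ => v q.1 q.2) domain) {s x : ℝ}
    (hs : s ∈ Icc 0 t) (hx : x ∈ Icc (0 : ℝ) 1) : vmin v t ≤ v s x :=
  csInf_le ((isCompact_Icc.prod isCompact_Icc).bddBelow_image (hv.mono (Icc_prod_subset_domain t)))
    (mem_image_of_mem (fun q : ℝ × ℝ => v q.1 q.2) (mk_mem_prod hs hx))

theorem IsPosC1.vmin_pos (hv : IsPosC1 v) (ht : 0 ≤ t) : 0 < vmin v t := by
  obtain ⟨q, hq, h⟩ := (isCompact_Icc.prod isCompact_Icc).exists_sInf_image_eq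
    (s := Icc 0 t ×ˢ Icc (0 : ℝ) 1) ⟨(0, 0), ⟨le_rfl, ht⟩, le_rfl, zero_le_one⟩
    (hv.1.continuousOn.mono (Icc_prod_subset_domain t))
  rw [vmin, h]
  exact hv.2 _ _ hq.1.1 hq.2

theorem IsC1.le_vmax (hv : IsC1 v) {s x : ℝ} (hs : s ∈ Icc 0 t) (hx : x ∈ Icc (0 : ℝ) 1) :
    spaceDeriv v s x ≤ vmax v t :=
  le_csSup ((isCompact_Icc.prod isCompact_Icc).bddAbove_image
      (hv.continuousOn_spaceDeriv.mono (Icc_prod_subset_domain t)))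
    (mem_image_of_mem (fun q : ℝ × ℝ => spaceDeriv v q.1 q.2) (mk_mem_prod hs hx))

theorem le_maxOn {a c : ℝ} {f : ℝ → ℝ} (hf : ContinuousOn f (Icc a c)) {s : ℝ}
    (hs : s ∈ Icc a c) : f s ≤ maxOn a c f :=
  le_csSup (isCompact_Icc.bddAbove_image hf) (mem_image_of_mem f hs)

theorem maxOn_le {a c C : ℝ} {f : ℝ → ℝ} (hac : a ≤ c) (hf : ∀ s ∈ Icc a c, f s ≤ C) :
    maxOn a c f ≤ C :=
  csSup_le ((nonempty_Icc.2 hac).image f) (forall_mem_image.2 hf)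

/-- Only boundedness of `g` is used, so continuity in time of the norms of ∂v/∂x never has to be
proved. -/
theorem le_memoryMax {μ C : ℝ} {g : ℝ → ℝ} (hμ : 0 < μ)
    (hg : ∀ s ∈ Icc 0 t, 0 ≤ g s ∧ g s ≤ C) {s : ℝ}
    (hs : s ∈ Icc (max 0 (t - 1 / vmin v t)) t) :
    g s ≤ memoryMax v t μ g * Real.exp (μ * (t - s)) := by
  have hb : BddAbove ((fun s => g s * Real.exp (-μ * (t - s))) ''
      Icc (max 0 (t - 1 / vmin v t)) t) := by
    refine ⟨C, forall_mem_image.2 fun r hr => ?_⟩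
    have h := hg r ⟨(le_max_left _ _).trans hr.1, hr.2⟩
    refine (mul_le_of_le_one_right h.1 (Real.exp_le_one_iff.2 ?_)).trans h.2
    rw [neg_mul, neg_nonpos]
    exact mul_nonneg hμ.le (sub_nonneg.2 hr.2)
  have h : g s * Real.exp (-μ * (t - s)) ≤ memoryMax v t μ g := le_csSup hb (mem_image_of_mem _ hs)
  calc g s = g s * Real.exp (-μ * (t - s)) * Real.exp (μ * (t - s)) := by
        rw [mul_assoc, ← Real.exp_add, neg_mul, neg_add_cancel, Real.exp_zero, mul_one]
    _ ≤ _ := by gcongr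

theorem memoryMax_nonneg {μ C : ℝ} {g : ℝ → ℝ} (hμ : 0 < μ) (ht : 0 ≤ t) (hv : 0 < vmin v t)
    (hg : ∀ s ∈ Icc 0 t, 0 ≤ g s ∧ g s ≤ C) : 0 ≤ memoryMax v t μ g := by
  have h := le_memoryMax (v := v) hμ hg (s := t)
    ⟨max_le ht (sub_le_self _ (one_div_pos.2 hv).le), le_rfl⟩
  rw [sub_self, mul_zero, Real.exp_zero, mul_one] at h
  exact (hg t ⟨ht, le_rfl⟩).1.trans h

end Extrema

/-! ### The logarithmic equation along characteristics -/

/-- `u` is a `C¹` solution of `∂u/∂t + v ∂u/∂x = -∂v/∂x` with boundary value `b` and initial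
profile `u₀`. -/
structure IsLogSolution (u₀ b : ℝ → ℝ) (v u : ℝ → ℝ → ℝ) : Prop where
  isC1 : IsC1 u
  pde : ∀ t x : ℝ, 0 ≤ t → x ∈ Icc (0 : ℝ) 1 →
    timeDeriv u t x + v t x * spaceDeriv u t x = -spaceDeriv v t x
  boundary : ∀ t : ℝ, 0 ≤ t → u t 0 = b t
  initial : ∀ x ∈ Icc (0 : ℝ) 1, u 0 x = u₀ x

theorem IsSolution.isLogSolution {ρs : ℝ} (hρs : 0 < ρs) {ρ0 b : ℝ → ℝ} {v ρ : ℝ → ℝ → ℝ}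
    (h : IsSolution ρs ρ0 b v ρ) (h0 : ρs * Real.exp (b 0) = ρ0 0) :
    IsLogSolution (fun x => Real.log (ρ0 x / ρs)) b v (fun t x => Real.log (ρ t x / ρs)) := by
  have hne : ∀ t x, 0 ≤ t → x ∈ Icc (0 : ℝ) 1 → ρ t x / ρs ≠ 0 := fun t x ht hx =>
    (div_pos (h.posC1.2 t x ht hx) hρs).ne'
  refine ⟨?_, fun t x ht hx => ?_, fun t ht => ?_, fun x hx => ?_⟩
  · exact ContDiffOn.log (h.posC1.1.div_const ρs) fun q hq => hne q.1 q.2 hq.1 hq.2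
  · have hp := HasFDerivWithinAt.partials (h.posC1.1.hasFDerivWithinAt ht hx) ht hx
    have hρ := (h.posC1.2 t x ht hx).ne'
    have e1 := timeDeriv_eq (u := fun t x => Real.log (ρ t x / ρs)) ht ((hp.1.div_const ρs).log (hne t x ht hx))
    have e2 := spaceDeriv_eq (u := fun t x => Real.log (ρ t x / ρs)) hx
      ((hp.2.div_const ρs).log (hne t x ht hx))
    have := h.pde t x ht hx
    rw [timeDeriv_eq ht hp.1, spaceDeriv_eq hx hp.2] at this
    rw [e1, e2]
    field_simp
    linarith
  · simp only [h.boundary t ht, mul_div_cancel_left₀ _ hρs.ne', Real.log_exp]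
  -- The initial condition excludes x = 0; there the boundary condition and the zeroth-order
  -- compatibility condition supply the value.
  · rcases hx.1.eq_or_lt with rfl | hx0
    · simp only [h.boundary 0 le_rfl, h0]
    · simp only [h.initial x ⟨hx0, hx.2⟩]

namespace IsPosExtension

variable {v F F' : ℝ → ℝ → ℝ}

theorem strictMono_flow_time (h : IsPosExtension v F F') (t x : ℝ) : StrictMono (h.flow t x) :=
  strictMono_of_deriv_pos fun s => by
    rw [(h.hasDerivAt_flow t x s).deriv]
    exact h.pos _ _

/-- Trajectories increase in time, so nonnegativity at time `s` and x ≤ 1 at time `t` confine the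
trajectory in between. This is why 0 ≤ flow is the only condition checked later on. -/
theorem flow_mem (h : IsPosExtension v F F') {t x s r : ℝ} (hx : x ≤ 1) (hs : 0 ≤ h.flow t x s)
    (hsr : s ≤ r) (hrt : r ≤ t) : h.flow t x r ∈ Icc (0 : ℝ) 1 := by
  have hm := (h.strictMono_flow_time t x).monotone
  refine ⟨hs.trans (hm hsr), (hm hrt).trans ?_⟩
  rwa [h.flow_self]

theorem exists_flow_eq_zero (h : IsPosExtension v F F') {t x : ℝ} (ht : 0 ≤ t) (hx : 0 ≤ x)
    (h0 : h.flow t x 0 ≤ 0) : ∃ s ∈ Icc 0 t, h.flow t x s = 0 :=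
  intermediate_value_Icc ht (h.continuous_flow_time t x).continuousOn
    ⟨h0, by rwa [h.flow_self]⟩

/-- The speed is at least v_min while the trajectory stays in the domain; this is the source of the
finite memory 1/v_min. -/
theorem vmin_mul_le (h : IsPosExtension v F F') (hv : IsPosC1 v) {t x s : ℝ} (hx : x ≤ 1)
    (hs0 : 0 ≤ s) (hst : s ≤ t) (hs : 0 ≤ h.flow t x s) :
    vmin v t * (t - s) ≤ x - h.flow t x s := by
  have := (convex_Icc s t).mul_sub_le_image_sub_of_le_deriv
    (h.continuous_flow_time t x).continuousOn
    (fun r _ => (h.hasDerivAt_flow t x r).differentiableAt.differentiableWithinAt)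
    (C := vmin v t) (fun r hr => by
      have hr' := interior_subset hr
      have hm := h.flow_mem hx hs hr'.1 hr'.2
      rw [(h.hasDerivAt_flow t x r).deriv, h.eq _ _ (hs0.trans hr'.1) hm]
      exact vmin_le hv.1.continuousOn ⟨hs0.trans hr'.1, hr'.2⟩ hm)
    s (left_mem_Icc.2 hst) t (right_mem_Icc.2 hst) hst
  rwa [h.flow_self] at this

theorem eq_sub_integral (h : IsPosExtension v F F') {u₀ b : ℝ → ℝ} {u : ℝ → ℝ → ℝ}
    (hu : IsLogSolution u₀ b v u) {t x s : ℝ} (hx : x ≤ 1)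
    (hs0 : 0 ≤ s) (hst : s ≤ t) (hs : 0 ≤ h.flow t x s) :
    u t x = u s (h.flow t x s) - ∫ r in s..t, F' r (h.flow t x r) := by
  have hS : ∀ r ∈ Icc s t, 0 ≤ r ∧ h.flow t x r ∈ Icc (0 : ℝ) 1 := fun r hr =>
    ⟨hs0.trans hr.1, h.flow_mem hx hs hr.1 hr.2⟩
  have hc : Continuous fun r => F' r (h.flow t x r) :=
    h.cont'.comp (continuous_id.prodMk (h.continuous_flow_time t x))
  have hd : ∀ r ∈ Icc s t, HasDerivWithinAt (fun r => u r (h.flow t x r))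
      (-F' r (h.flow t x r)) (Icc s t) r := fun r hr => by
    have := hu.isC1.hasDerivWithinAt_curve hr hS (h.hasDerivAt_flow t x r)
    rwa [h.eq _ _ (hS r hr).1 (hS r hr).2, hu.pde _ _ (hS r hr).1 (hS r hr).2,
      ← h.eq' _ _ (hS r hr).1 (hS r hr).2] at this
  have := intervalIntegral.integral_eq_sub_of_hasDerivAt_of_le hst
    (fun r hr => (hd r hr).continuousWithinAt)
    (fun r hr => (hd r (Ioo_subset_Icc_self hr)).hasDerivAt (Icc_mem_nhds hr.1 hr.2))
    (hc.neg.intervalIntegrable _ _)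
  rw [intervalIntegral.integral_neg, h.flow_self] at this
  linarith

theorem eq_of_isLogSolution (h : IsPosExtension v F F') {u₀ b : ℝ → ℝ} {u w : ℝ → ℝ → ℝ}
    (hu : IsLogSolution u₀ b v u) (hw : IsLogSolution u₀ b v w) {t x : ℝ} (ht : 0 ≤ t)
    (hx : x ∈ Icc (0 : ℝ) 1) : u t x = w t x := by
  rcases le_total (h.flow t x 0) 0 with h0 | h0
  · obtain ⟨s, hs, hs'⟩ := h.exists_flow_eq_zero ht hx.1 h0
    rw [h.eq_sub_integral hu hx.2 hs.1 hs.2 hs'.ge, h.eq_sub_integral hw hx.2 hs.1 hs.2 hs'.ge,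
      hs', hu.boundary _ hs.1, hw.boundary _ hs.1]
  · have hm := h.flow_mem hx.2 h0 le_rfl ht
    rw [h.eq_sub_integral hu hx.2 le_rfl ht h0, h.eq_sub_integral hw hx.2 le_rfl ht h0,
      hu.initial _ hm, hw.initial _ hm]

/-- The pointwise bound along the characteristic ending at `(t, x)`. -/
theorem exists_abs_le (h : IsPosExtension v F F') (hv : IsPosC1 v) {u₀ b : ℝ → ℝ}
    {u : ℝ → ℝ → ℝ} (hu : IsLogSolution u₀ b v u) {μ C : ℝ} (hμ : 0 < μ) {t x : ℝ} (ht : 0 ≤ t)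
    (hb : ∀ s ∈ Icc 0 t, |b s| ≤ C) (hx : x ∈ Icc (0 : ℝ) 1) :
    ∃ s ∈ Icc (max 0 (t - 1 / vmin v t)) t, 0 ≤ h.flow t x s ∧
      |u t x| ≤ stepH (t - 1 / vmin v t) * (if 0 ≤ h.flow t x 0 then |u₀ (h.flow t x 0)| else 0)
        + memoryMax v t μ (fun s => |b s|) * Real.exp (μ * x / vmin v t)
        + ∫ r in s..t, |F' r (h.flow t x r)| := by
  have hm := hv.vmin_pos ht
  have hb' : ∀ s ∈ Icc 0 t, 0 ≤ |b s| ∧ |b s| ≤ C := fun s hs => ⟨abs_nonneg _, hb s hs⟩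
  have hB := memoryMax_nonneg (v := v) hμ ht hm hb'
  have hstep : 0 ≤ stepH (t - 1 / vmin v t) *
      (if 0 ≤ h.flow t x 0 then |u₀ (h.flow t x 0)| else 0) := by
    unfold stepH
    split_ifs <;> positivity
  have main : ∀ s, 0 ≤ s → s ≤ t → 0 ≤ h.flow t x s →
      t - s ≤ x / vmin v t ∧ s ∈ Icc (max 0 (t - 1 / vmin v t)) t ∧
      |u t x| ≤ |u s (h.flow t x s)| + ∫ r in s..t, |F' r (h.flow t x r)| := by
    intro s hs0 hst hs
    have h1 := h.vmin_mul_le hv hx.2 hs0 hst hs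
    have h2 : t - s ≤ x / vmin v t := by
      rw [le_div_iff₀' hm]; linarith
    have h3 : x / vmin v t ≤ 1 / vmin v t := by gcongr; exact hx.2
    refine ⟨h2, ⟨max_le hs0 (by linarith), hst⟩, ?_⟩
    rw [h.eq_sub_integral hu hx.2 hs0 hst hs]
    exact (abs_sub _ _).trans (by
      gcongr
      exact intervalIntegral.abs_integral_le_integral_abs hst)
  -- The inequality is strict because `stepH` vanishes at 0: the initial case must yield t <
  -- 1/v_min. A trajectory starting from the corner counts as a boundary case.
  by_cases h0 : 0 < h.flow t x 0
  · obtain ⟨-, h3, h4⟩ := main 0 le_rfl ht h0.le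
    refine ⟨0, h3, h0.le, h4.trans ?_⟩
    have hlt : t < 1 / vmin v t := by
      have := h.vmin_mul_le hv hx.2 le_rfl ht h0.le
      rw [lt_div_iff₀' hm]
      linarith [hx.2]
    rw [stepH, if_pos (sub_neg.2 hlt), if_pos h0.le, one_mul,
      hu.initial _ (h.flow_mem hx.2 h0.le le_rfl ht)]
    gcongr
    exact le_add_of_nonneg_right (by positivity)
  · obtain ⟨s, hs, hs'⟩ := h.exists_flow_eq_zero ht hx.1 (not_lt.1 h0)
    obtain ⟨h2, h3, h4⟩ := main s hs.1 hs.2 hs'.ge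
    refine ⟨s, h3, hs'.ge, h4.trans ?_⟩
    gcongr
    rw [hs', hu.boundary s hs.1]
    -- The weight exp(μ(t - s)) is at most exp(μx / v_min), since covering the distance x takes at
    -- most x / v_min. Keeping x here produces the sharper constant in the L^p estimate.
    refine (le_memoryMax (v := v) hμ hb' h3).trans (le_add_of_nonneg_of_le hstep ?_)
    rw [mul_div_assoc]
    gcongr

end IsPosExtension

/-! ### Minkowski's inequality and norms on (0, 1) -/

/-- Minkowski's integral inequality. -/
theorem lintegral_Lp_lintegral_le {α β : Type*} [MeasurableSpace α] [MeasurableSpace β]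
    {μ : Measure α} {ν : Measure β} [SFinite μ] [SFinite ν] {q : α → β → ℝ≥0∞}
    (hq : Measurable (Function.uncurry q)) {p : ℝ} (hp : 1 < p) {n : β → ℝ≥0∞}
    (hn : ∀ᵐ s ∂ν, (∫⁻ x, q x s ^ p ∂μ) ^ (1 / p) ≤ n s)
    (hfin : ∫⁻ x, (∫⁻ s, q x s ∂ν) ^ p ∂μ ≠ ⊤) :
    (∫⁻ x, (∫⁻ s, q x s ∂ν) ^ p ∂μ) ^ (1 / p) ≤ ∫⁻ s, n s ∂ν := by
  set S : α → ℝ≥0∞ := fun x => ∫⁻ s, q x s ∂ν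
  have hS : Measurable S := hq.lintegral_prod_right
  set K := ∫⁻ x, S x ^ p ∂μ with hK
  have hpq := Real.HolderConjugate.conjExponent hp
  set r := Real.conjExponent p
  have hSp : Measurable fun x => S x ^ (p - 1) := hS.pow_const _
  have hKr : ∫⁻ x, (S x ^ (p - 1)) ^ r ∂μ = K := by
    simp only [← ENNReal.rpow_mul, hpq.sub_one_mul_conj, hK]
  -- Split S^p as S · S^(p-1), exchange the integrals and apply Hölder in `x`; cancelling K^(1/r)
  -- afterwards requires K to be nonzero and finite.
  have h1 : K ≤ (∫⁻ s, n s ∂ν) * K ^ (1 / r) := by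
    calc K = ∫⁻ x, ∫⁻ s, q x s * S x ^ (p - 1) ∂ν ∂μ := by
          refine lintegral_congr fun x => ?_
          rw [lintegral_mul_const _ (f := fun s => q x s) (hq.comp measurable_prodMk_left)]
          change S x ^ p = S x * S x ^ (p - 1)
          have : S x ^ p = S x ^ (1 + (p - 1)) := by rw [add_sub_cancel]
          rw [this, ENNReal.rpow_add_of_nonneg _ _ zero_le_one (sub_nonneg.2 hp.le),
            ENNReal.rpow_one]
      _ = ∫⁻ s, ∫⁻ x, q x s * S x ^ (p - 1) ∂μ ∂ν :=
          lintegral_lintegral_swap (hq.mul (hSp.comp measurable_fst)).aemeasurable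
      _ ≤ ∫⁻ s, n s * K ^ (1 / r) ∂ν := by
          refine lintegral_mono_ae (hn.mono fun s hs => ?_)
          refine (ENNReal.lintegral_mul_le_Lp_mul_Lq μ hpq
            (hq.comp measurable_prodMk_right).aemeasurable hSp.aemeasurable).trans ?_
          rw [hKr]
          gcongr
          exact hs
      _ = _ := lintegral_mul_const' _ _ (ENNReal.rpow_ne_top_of_nonneg
          (one_div_nonneg.2 hpq.symm.nonneg) hfin)
  rcases eq_or_ne K 0 with h0 | h0
  · rw [h0, ENNReal.zero_rpow_of_pos (one_div_pos.2 hpq.pos)]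
    exact zero_le
  have h2 : K = K ^ (1 / p) * K ^ (1 / r) := by
    rw [← ENNReal.rpow_add _ _ h0 hfin, hpq.one_div_add_one_div, div_one, ENNReal.rpow_one]
  refine (ENNReal.mul_le_mul_iff_left (c := K ^ (1 / r)) ?_ ?_).1 (h2.symm.trans_le h1)
  · simp [h0, hfin]
  · exact ENNReal.rpow_ne_top_of_nonneg (one_div_nonneg.2 hpq.symm.nonneg) hfin

theorem ofReal_normLp {p : ℝ} (hp : 0 < p) {f : ℝ → ℝ} (hf : ContinuousOn f (Icc 0 1)) :
    ENNReal.ofReal (normLp p f) = (∫⁻ x in Icc (0 : ℝ) 1, ‖f x‖ₑ ^ p) ^ (1 / p) := by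
  have hc : ContinuousOn (fun x => |f x| ^ p) (Icc 0 1) :=
    hf.abs.rpow_const fun x _ => Or.inr hp.le
  rw [normLp, intervalIntegral.integral_of_le zero_le_one, ← integral_Icc_eq_integral_Ioc,
    ← ENNReal.ofReal_rpow_of_nonneg (integral_nonneg fun x => by positivity)
      (one_div_nonneg.2 hp.le),
    ofReal_integral_eq_lintegral_ofReal hc.integrableOn_Icc (ae_of_all _ fun x => by positivity)]
  congr 1
  refine lintegral_congr fun x => ?_
  rw [Real.enorm_eq_ofReal_abs, ENNReal.ofReal_rpow_of_nonneg (abs_nonneg _) hp.le]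

theorem normLp_nonneg (p : ℝ) (f : ℝ → ℝ) : 0 ≤ normLp p f :=
  Real.rpow_nonneg (intervalIntegral.integral_nonneg zero_le_one fun x _ => by positivity) _

theorem normLp_le {p C : ℝ} (hp : 0 < p) (hC : 0 ≤ C) {f : ℝ → ℝ} (hf : ContinuousOn f (Icc 0 1))
    (h : ∀ x ∈ Icc (0 : ℝ) 1, |f x| ≤ C) : normLp p f ≤ C := by
  rw [← ENNReal.ofReal_le_ofReal_iff hC, ofReal_normLp hp hf]
  calc (∫⁻ x in Icc (0 : ℝ) 1, ‖f x‖ₑ ^ p) ^ (1 / p)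
      ≤ (∫⁻ _ in Icc (0 : ℝ) 1, ENNReal.ofReal C ^ p) ^ (1 / p) := by
        gcongr ?_ ^ _
        refine setLIntegral_mono measurable_const fun x hx => ?_
        gcongr
        rw [Real.enorm_eq_ofReal_abs]
        exact ENNReal.ofReal_le_ofReal (h x hx)
    _ = ENNReal.ofReal C := by
        rw [setLIntegral_const, Real.volume_Icc, sub_zero, ENNReal.ofReal_one, mul_one,
          ← ENNReal.rpow_mul, mul_one_div_cancel hp.ne', ENNReal.rpow_one]

theorem eLpNorm_top_le {C : ℝ} {f : ℝ → ℝ} (h : ∀ x ∈ Icc (0 : ℝ) 1, |f x| ≤ C) :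
    eLpNorm f ⊤ (volume.restrict (Ioo (0 : ℝ) 1)) ≤ ENNReal.ofReal C := by
  rw [eLpNorm_exponent_top]
  refine eLpNormEssSup_le_of_ae_bound ?_
  filter_upwards [ae_restrict_mem measurableSet_Ioo] with x hx
  exact h x (Ioo_subset_Icc_self hx)

theorem normLinfty_le {C : ℝ} (hC : 0 ≤ C) {f : ℝ → ℝ} (h : ∀ x ∈ Icc (0 : ℝ) 1, |f x| ≤ C) :
    normLinfty f ≤ C :=
  ENNReal.toReal_le_of_le_ofReal hC (eLpNorm_top_le h)

/-- For continuous `f`, the part of (0, 1) where |f| exceeds its essential supremum is open and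
null, hence empty; the endpoints follow by closure. -/
theorem abs_le_normLinfty {f : ℝ → ℝ} (hf : ContinuousOn f (Icc 0 1)) {x : ℝ}
    (hx : x ∈ Icc (0 : ℝ) 1) : |f x| ≤ normLinfty f := by
  obtain ⟨C, hC⟩ := isCompact_Icc.exists_bound_of_continuousOn hf
  have hfin : eLpNorm f ⊤ (volume.restrict (Ioo (0 : ℝ) 1)) ≠ ⊤ :=
    ((eLpNorm_top_le hC).trans_lt ENNReal.ofReal_lt_top).ne
  have hae : ∀ᵐ y ∂volume.restrict (Ioo (0 : ℝ) 1), |f y| ≤ normLinfty f := by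
    rw [eLpNorm_exponent_top] at hfin
    filter_upwards [ae_le_eLpNormEssSup (f := f) (μ := volume.restrict (Ioo (0 : ℝ) 1))] with y hy
    rw [normLinfty, eLpNorm_exponent_top, ← Real.norm_eq_abs, ← toReal_enorm]
    exact ENNReal.toReal_mono hfin hy
  have hopen : IsOpen (Ioo (0 : ℝ) 1 ∩ (fun y => |f y|) ⁻¹' Ioi (normLinfty f)) :=
    (hf.mono Ioo_subset_Icc_self).abs.isOpen_inter_preimage isOpen_Ioo isOpen_Ioi
  have hnull : volume (Ioo (0 : ℝ) 1 ∩ (fun y => |f y|) ⁻¹' Ioi (normLinfty f)) = 0 := by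
    rw [ae_restrict_iff' measurableSet_Ioo] at hae
    refine measure_mono_null (fun y hy => ?_) (ae_iff.1 hae)
    exact fun h => (not_lt.2 (h hy.1)) hy.2
  have hempty := hopen.measure_eq_zero_iff volume |>.1 hnull
  have hsub : ∀ y ∈ Ioo (0 : ℝ) 1, |f y| ≤ normLinfty f := fun y hy => by
    by_contra hlt
    have : y ∈ Ioo (0 : ℝ) 1 ∩ (fun y => |f y|) ⁻¹' Ioi (normLinfty f) := ⟨hy, not_le.1 hlt⟩
    rw [hempty] at this
    exact this
  refine ContinuousWithinAt.closure_le (s := Ioo (0 : ℝ) 1) (f := fun y => |f y|)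
    (g := fun _ => normLinfty f) ?_ ((hf x hx).abs.mono Ioo_subset_Icc_self)
    continuousWithinAt_const hsub
  rwa [closure_Ioo zero_ne_one]

/-! ### Transport of integrals and the sup-norm estimate -/

namespace IsPosExtension

variable {v F F' : ℝ → ℝ → ℝ}

theorem exists_abs_spaceDeriv_le (h : IsPosExtension v F F') (t : ℝ) :
    ∃ C : NNReal, ∀ s ∈ Icc 0 t, ∀ x ∈ Icc (0 : ℝ) 1, |spaceDeriv v s x| ≤ C := by
  obtain ⟨C, hC⟩ := h.bound t
  refine ⟨C, fun s hs x hx => ?_⟩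
  rw [← h.eq' s x hs.1 hx]
  exact (hC s x (by rw [abs_of_nonneg hs.1]; exact hs.2)).2

/-- Transport from time `s` to time `t` increases integrals at most by the factor
`exp (vmax (t - s))`. -/
theorem lintegral_flow_le (h : IsPosExtension v F F') (hv : IsC1 v) {s t : ℝ} (hs : 0 ≤ s)
    (hst : s ≤ t) (q : ℝ → ℝ≥0∞) :
    ∫⁻ x in Icc (0 : ℝ) 1, (if 0 ≤ h.flow t x s then q (h.flow t x s) else 0) ≤
      ENNReal.ofReal (Real.exp (vmax v t * (t - s))) * ∫⁻ y in Icc (0 : ℝ) 1, q y := by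
  set D : Set ℝ := {x | 0 ≤ h.flow t x s}
  have hcont : Continuous fun x => h.flow t x s :=
    h.continuous_flow_comp continuous_const continuous_id continuous_const
  have hD : MeasurableSet D := (isClosed_le continuous_const hcont).measurableSet
  have hE : MeasurableSet (Icc (0 : ℝ) 1 ∩ D) := measurableSet_Icc.inter hD
  -- The derivative of the backward map is exp(-∫ ∂v/∂x) along a trajectory inside the domain, where
  -- ∂v/∂x ≤ v_max. The change of variables below inverts this bound.
  have hderiv : ∀ x ∈ Icc (0 : ℝ) 1 ∩ D,
      Real.exp (-(vmax v t * (t - s))) ≤ h.flowDeriv t x s := fun x hx => by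
    have hc : Continuous fun r => F' r (h.flow t x r) :=
      h.cont'.comp (continuous_id.prodMk (h.continuous_flow_time t x))
    rw [IsVelocity.flowDeriv, Real.exp_le_exp, intervalIntegral.integral_symm, neg_le_neg_iff]
    calc ∫ r in s..t, F' r (h.flow t x r) ≤ ∫ _ in s..t, vmax v t := by
          refine intervalIntegral.integral_mono_on hst (hc.intervalIntegrable _ _)
            intervalIntegrable_const fun r hr => ?_
          have hm := h.flow_mem hx.1.2 hx.2 hr.1 hr.2
          rw [h.eq' _ _ (hs.trans hr.1) hm]
          exact hv.le_vmax ⟨hs.trans hr.1, hr.2⟩ hm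
      _ = vmax v t * (t - s) := by rw [intervalIntegral.integral_const, smul_eq_mul, mul_comm]
  calc ∫⁻ x in Icc (0 : ℝ) 1, (if 0 ≤ h.flow t x s then q (h.flow t x s) else 0)
      = ∫⁻ x in Icc (0 : ℝ) 1, D.indicator (fun x => q (h.flow t x s)) x := rfl
    _ = ∫⁻ x in Icc (0 : ℝ) 1 ∩ D, q (h.flow t x s) := by
        rw [setLIntegral_indicator hD, inter_comm]
    _ ≤ ∫⁻ x in Icc (0 : ℝ) 1 ∩ D, ENNReal.ofReal (Real.exp (vmax v t * (t - s))) *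
          (ENNReal.ofReal |h.flowDeriv t x s| * q (h.flow t x s)) := by
        refine setLIntegral_mono' hE fun x hx => ?_
        rw [← mul_assoc, ← ENNReal.ofReal_mul (Real.exp_pos _).le]
        refine le_mul_of_one_le_left' (ENNReal.one_le_ofReal.2 ?_)
        rw [abs_of_pos (h.flowDeriv_pos t x s)]
        calc (1 : ℝ) = Real.exp (vmax v t * (t - s)) * Real.exp (-(vmax v t * (t - s))) := by
              rw [← Real.exp_add, add_neg_cancel, Real.exp_zero]
          _ ≤ _ := by gcongr; exact hderiv x hx
    _ = ENNReal.ofReal (Real.exp (vmax v t * (t - s))) *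
          ∫⁻ y in (fun x => h.flow t x s) '' (Icc (0 : ℝ) 1 ∩ D), q y := by
        rw [lintegral_const_mul' _ _ ENNReal.ofReal_ne_top,
          lintegral_image_eq_lintegral_abs_deriv_mul hE
            (fun x _ => (h.hasDerivAt_flow_space t x s).hasDerivWithinAt)
            (h.strictMono_flow t s).injective.injOn]
    _ ≤ _ := by
        gcongr
        rintro _ ⟨x, hx, rfl⟩
        exact h.flow_mem hx.1.2 hx.2 le_rfl hst

theorem supEstimate (h : IsPosExtension v F F') (hv : IsPosC1 v) {u₀ b : ℝ → ℝ}
    {u : ℝ → ℝ → ℝ} (hu : IsLogSolution u₀ b v u) (hu₀ : ContinuousOn u₀ (Icc 0 1))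
    (hb : ContinuousOn b (Ici 0)) {t μ : ℝ} (ht : 0 ≤ t) (hμ : 0 < μ) :
    maxOn 0 1 (fun x => |u t x|) ≤
      stepH (t - 1 / vmin v t) * maxOn 0 1 (fun x => |u₀ x|)
      + 1 / vmin v t * Real.exp (1 + μ / vmin v t) *
          memoryMax v t μ (fun s => normLinfty (spaceDeriv v s))
      + Real.exp (μ / vmin v t) * memoryMax v t μ (fun s => |b s|) := by
  have hm := hv.vmin_pos ht
  obtain ⟨Cb, hCb⟩ := (isCompact_Icc (a := 0) (b := t)).exists_bound_of_continuousOn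
    (hb.mono Icc_subset_Ici_self)
  obtain ⟨C, hC⟩ := h.exists_abs_spaceDeriv_le t
  have hB := memoryMax_nonneg (v := v) hμ ht hm fun s hs => ⟨abs_nonneg (b s), hCb s hs⟩
  have hg : ∀ s ∈ Icc 0 t, 0 ≤ normLinfty (spaceDeriv v s) ∧ normLinfty (spaceDeriv v s) ≤ C :=
    fun s hs => ⟨ENNReal.toReal_nonneg, normLinfty_le C.2 (hC s hs)⟩
  have hM := memoryMax_nonneg (v := v) hμ ht hm hg
  set M := memoryMax v t μ (fun s => normLinfty (spaceDeriv v s))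
  set B := memoryMax v t μ (fun s => |b s|)
  refine maxOn_le zero_le_one fun x hx => ?_
  obtain ⟨s, hs, hs0, hle⟩ := h.exists_abs_le hv hu hμ ht hCb hx
  have hs' : 0 ≤ s := (le_max_left _ _).trans hs.1
  refine hle.trans ?_
  have e1 : (if 0 ≤ h.flow t x 0 then |u₀ (h.flow t x 0)| else 0) ≤
      maxOn 0 1 (fun x => |u₀ x|) := by
    split_ifs with h0
    · exact le_maxOn hu₀.abs (h.flow_mem hx.2 h0 le_rfl ht)
    · exact (abs_nonneg _).trans (le_maxOn hu₀.abs ⟨le_rfl, zero_le_one⟩)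
  have e2 : Real.exp (μ * x / vmin v t) ≤ Real.exp (μ / vmin v t) := by
    gcongr
    exact mul_le_of_le_one_right hμ.le hx.2
  have hlen : t - s ≤ 1 / vmin v t := by
    linarith [le_max_right 0 (t - 1 / vmin v t), hs.1]
  have e3 : ∫ r in s..t, |F' r (h.flow t x r)| ≤ 1 / vmin v t * Real.exp (1 + μ / vmin v t) * M := by
    have hc : Continuous fun r => F' r (h.flow t x r) :=
      h.cont'.comp (continuous_id.prodMk (h.continuous_flow_time t x))
    calc ∫ r in s..t, |F' r (h.flow t x r)| ≤ ∫ _ in s..t, Real.exp (1 + μ / vmin v t) * M := by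
          refine intervalIntegral.integral_mono_on hs.2 (hc.abs.intervalIntegrable _ _)
            intervalIntegrable_const fun r hr => ?_
          have hfm := h.flow_mem hx.2 hs0 hr.1 hr.2
          have hr0 := hs'.trans hr.1
          rw [h.eq' _ _ hr0 hfm, mul_comm]
          refine (abs_le_normLinfty (hv.1.continuousOn_spaceDeriv_apply hr0) hfm).trans ?_
          refine (le_memoryMax (v := v) hμ hg ⟨hs.1.trans hr.1, hr.2⟩).trans ?_
          gcongr
          calc μ * (t - r) ≤ μ * (1 / vmin v t) := by gcongr; linarith [hr.1]
            -- The summand 1 is slack here, because μ > 0.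
            _ ≤ 1 + μ / vmin v t := by rw [mul_one_div]; linarith
      _ = (t - s) * (Real.exp (1 + μ / vmin v t) * M) := by
          rw [intervalIntegral.integral_const, smul_eq_mul]
      _ ≤ _ := by rw [mul_assoc]; gcongr
  have hstep : 0 ≤ stepH (t - 1 / vmin v t) := by unfold stepH; split_ifs <;> simp
  have e1' := mul_le_mul_of_nonneg_left e1 hstep
  have e2' := mul_le_mul_of_nonneg_left e2 hB
  linarith

end IsPosExtension

/-! ### The L^p estimate -/

theorem lintegral_exp_rpow {B lam p μ : ℝ} (hB : 0 ≤ B) (hlam : 0 < lam) (hp : 0 < p)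
    (hμ : 0 < μ) :
    (∫⁻ x in Icc (0 : ℝ) 1, ENNReal.ofReal (B * Real.exp (μ * x / lam)) ^ p) ^ (1 / p) =
      ENNReal.ofReal ((lam * ((Real.exp (p * μ / lam) - 1) / (p * μ))) ^ (1 / p) * B) := by
  have hf : ContinuousOn (fun x => B * Real.exp (μ * x / lam)) (Icc 0 1) := by fun_prop
  have h1 : ∀ x : ℝ, ENNReal.ofReal (B * Real.exp (μ * x / lam)) =
      ‖B * Real.exp (μ * x / lam)‖ₑ := fun x => by
    rw [Real.enorm_eq_ofReal (by positivity)]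
  simp_rw [h1]
  rw [← ofReal_normLp hp hf, normLp]
  congr 1
  have hc : p * μ / lam ≠ 0 := by positivity
  have h2 : ∀ x : ℝ, |B * Real.exp (μ * x / lam)| ^ p = B ^ p * Real.exp (p * μ / lam * x) :=
    fun x => by
      rw [abs_of_nonneg (by positivity), Real.mul_rpow hB (Real.exp_pos _).le, ← Real.exp_mul]
      congr 2
      ring
  simp_rw [h2]
  rw [intervalIntegral.integral_const_mul, intervalIntegral.integral_comp_mul_left _ hc,
    integral_exp, mul_zero, mul_one, Real.exp_zero, smul_eq_mul]
  have h3 : 0 ≤ Real.exp (p * μ / lam) - 1 :=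
    sub_nonneg.2 (Real.one_le_exp (by positivity))
  rw [Real.mul_rpow (by positivity) (by positivity), ← Real.rpow_mul hB, mul_one_div_cancel hp.ne',
    Real.rpow_one, mul_comm]
  congr 2
  rw [inv_div]
  ring

theorem ite_rpow {P : Prop} [Decidable P] (a : ℝ≥0∞) {p : ℝ} (hp : 0 < p) :
    (if P then a else 0) ^ p = if P then a ^ p else 0 := by
  split_ifs
  · rfl
  · exact ENNReal.zero_rpow_of_pos hp

namespace IsPosExtension

variable {v F F' : ℝ → ℝ → ℝ}

theorem measurable_ite_flow (h : IsPosExtension v F F') (t : ℝ) {f : ℝ → ℝ → ℝ}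
    (hf : Continuous (Function.uncurry f)) :
    Measurable (Function.uncurry fun x s : ℝ =>
      if 0 ≤ h.flow t x s then ‖f s (h.flow t x s)‖ₑ else 0) := by
  have hc : Continuous fun q : ℝ × ℝ => h.flow t q.1 q.2 :=
    h.continuous_flow_comp continuous_const continuous_fst continuous_snd
  have hc2 : Continuous fun q : ℝ × ℝ => f q.2 (h.flow t q.1 q.2) :=
    hf.comp (continuous_snd.prodMk hc)
  exact Measurable.ite (isClosed_le continuous_const hc).measurableSet hc2.enorm.measurable
    measurable_const

/-- The contribution of the initial profile. -/
theorem initial_le (h : IsPosExtension v F F') (hv : IsC1 v) {f : ℝ → ℝ} (hf : Continuous f)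
    {t p c : ℝ} (ht : 0 ≤ t) (hp : 0 < p) (hc : 0 ≤ c) :
    (∫⁻ x in Icc (0 : ℝ) 1, (ENNReal.ofReal c *
      (if 0 ≤ h.flow t x 0 then ‖f (h.flow t x 0)‖ₑ else 0)) ^ p) ^ (1 / p) ≤
      ENNReal.ofReal (Real.exp (p⁻¹ * vmax v t * t) * c * normLp p f) := by
  have hle := h.lintegral_flow_le hv le_rfl ht fun y => ‖f y‖ₑ ^ p
  simp_rw [ENNReal.mul_rpow_of_nonneg _ _ hp.le, ite_rpow _ hp]
  rw [lintegral_const_mul' _ _ (ENNReal.rpow_ne_top_of_nonneg hp.le ENNReal.ofReal_ne_top),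
    ENNReal.mul_rpow_of_nonneg _ _ (one_div_nonneg.2 hp.le), ← ENNReal.rpow_mul,
    mul_one_div_cancel hp.ne', ENNReal.rpow_one, mul_comm (Real.exp _), mul_assoc,
    ENNReal.ofReal_mul hc, ENNReal.ofReal_mul (Real.exp_pos _).le,
    ofReal_normLp hp hf.continuousOn]
  gcongr
  refine (ENNReal.rpow_le_rpow hle (one_div_nonneg.2 hp.le)).trans_eq ?_
  rw [ENNReal.mul_rpow_of_nonneg _ _ (one_div_nonneg.2 hp.le),
    ENNReal.ofReal_rpow_of_nonneg (Real.exp_pos _).le (one_div_nonneg.2 hp.le), ← Real.exp_mul]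
  congr 3
  ring

/-- The contribution of the source term. -/
theorem source_le (h : IsPosExtension v F F') (hv : IsPosC1 v) {t p μ : ℝ} (ht : 0 ≤ t)
    (hp : 1 < p) (hμ : 0 < μ) (hμ' : -(p⁻¹ * vmax v t) - vmin v t < μ) :
    (∫⁻ x in Icc (0 : ℝ) 1, (∫⁻ s in Icc (max 0 (t - 1 / vmin v t)) t,
      (if 0 ≤ h.flow t x s then ‖F' s (h.flow t x s)‖ₑ else 0)) ^ p) ^ (1 / p) ≤
      ENNReal.ofReal (1 / vmin v t * Real.exp (1 + (μ + p⁻¹ * vmax v t) / vmin v t) *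
        memoryMax v t μ (fun s => normLp p (spaceDeriv v s))) := by
  have hp0 : 0 < p := zero_lt_one.trans hp
  have hm := hv.vmin_pos ht
  obtain ⟨C, hC⟩ := h.exists_abs_spaceDeriv_le t
  have hg : ∀ s ∈ Icc 0 t, 0 ≤ normLp p (spaceDeriv v s) ∧ normLp p (spaceDeriv v s) ≤ C :=
    fun s hs => ⟨normLp_nonneg _ _,
      normLp_le hp0 C.2 (hv.1.continuousOn_spaceDeriv_apply hs.1) (hC s hs)⟩
  have hM := memoryMax_nonneg (v := v) hμ ht hm hg
  set M := memoryMax v t μ (fun s => normLp p (spaceDeriv v s))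
  set k := μ + p⁻¹ * vmax v t with hk
  set J := Icc (max 0 (t - 1 / vmin v t)) t
  have hJ : ∀ s ∈ J, 0 ≤ s ∧ s ≤ t ∧ t - s ≤ 1 / vmin v t := fun s hs =>
    ⟨(le_max_left _ _).trans hs.1, hs.2, by linarith [(le_max_right 0 (t - 1 / vmin v t)), hs.1]⟩
  have hn : ∀ᵐ s ∂volume.restrict J, (∫⁻ x in Icc (0 : ℝ) 1,
      (if 0 ≤ h.flow t x s then ‖F' s (h.flow t x s)‖ₑ else 0) ^ p) ^ (1 / p) ≤
      ENNReal.ofReal (Real.exp (1 + k / vmin v t) * M) := by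
    filter_upwards [ae_restrict_mem measurableSet_Icc] with s hs
    obtain ⟨hs0, hst, hlen⟩ := hJ s hs
    have hle := h.lintegral_flow_le hv.1 hs0 hst fun y => ‖F' s y‖ₑ ^ p
    simp_rw [ite_rpow _ hp0]
    refine (ENNReal.rpow_le_rpow hle (one_div_nonneg.2 hp0.le)).trans ?_
    have hFv : ∫⁻ y in Icc (0 : ℝ) 1, ‖F' s y‖ₑ ^ p =
        ∫⁻ y in Icc (0 : ℝ) 1, ‖spaceDeriv v s y‖ₑ ^ p :=
      setLIntegral_congr_fun measurableSet_Icc fun y hy => by simp only [h.eq' s y hs0 hy]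
    rw [hFv, ENNReal.mul_rpow_of_nonneg _ _ (one_div_nonneg.2 hp0.le),
      ENNReal.ofReal_rpow_of_nonneg (Real.exp_pos _).le (one_div_nonneg.2 hp0.le), ← Real.exp_mul,
      ← ofReal_normLp hp0 (hv.1.continuousOn_spaceDeriv_apply hs0),
      ← ENNReal.ofReal_mul (Real.exp_pos _).le]
    refine ENNReal.ofReal_le_ofReal ?_
    calc Real.exp (vmax v t * (t - s) * (1 / p)) * normLp p (spaceDeriv v s)
        ≤ Real.exp (vmax v t * (t - s) * (1 / p)) * (M * Real.exp (μ * (t - s))) := by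
          gcongr
          exact le_memoryMax (v := v) hμ hg hs
      _ = Real.exp (k * (t - s)) * M := by
          rw [mul_left_comm, ← Real.exp_add, mul_comm M, hk]
          congr 2
          ring
      _ ≤ Real.exp (1 + k / vmin v t) * M := by
          gcongr
          have hts : 0 ≤ t - s := sub_nonneg.2 hst
          -- If k ≥ 0 the worst case is t - s = 1/v_min. If k ≤ 0 the left side is nonpositive, and
          -- the lower bound on μ gives k > -v_min, so the right side is positive: the extra 1 in
          -- the exponent is there for this case.
          rcases le_total 0 k with hk0 | hk0
          · calc k * (t - s) ≤ k * (1 / vmin v t) := by gcongr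
              _ ≤ 1 + k / vmin v t := by rw [mul_one_div]; linarith
          · have h1 : -1 < k / vmin v t := by
              rw [lt_div_iff₀ hm]; linarith
            linarith [mul_nonpos_of_nonpos_of_nonneg hk0 hts]
  have hlen : ENNReal.ofReal (t - max 0 (t - 1 / vmin v t)) ≤ ENNReal.ofReal (1 / vmin v t) :=
    ENNReal.ofReal_le_ofReal (by linarith [le_max_right 0 (t - 1 / vmin v t)])
  obtain ⟨C', hC'⟩ := h.bound t
  have hfin : ∫⁻ x in Icc (0 : ℝ) 1, (∫⁻ s in J,
      (if 0 ≤ h.flow t x s then ‖F' s (h.flow t x s)‖ₑ else 0)) ^ p ≠ ⊤ := by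
    have hb : ∀ x, (∫⁻ s in J, (if 0 ≤ h.flow t x s then ‖F' s (h.flow t x s)‖ₑ else 0)) ≤
        ENNReal.ofReal C' * volume J := fun x => by
      rw [← setLIntegral_const]
      refine setLIntegral_mono measurable_const fun s hs => ?_
      split_ifs
      · rw [Real.enorm_eq_ofReal_abs]
        exact ENNReal.ofReal_le_ofReal
          (hC' s _ (by rw [abs_of_nonneg (hJ s hs).1]; exact (hJ s hs).2.1)).2
      · exact zero_le
    refine ((lintegral_mono fun x => ENNReal.rpow_le_rpow (hb x) hp0.le).trans_lt ?_).ne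
    rw [setLIntegral_const]
    refine ENNReal.mul_lt_top (ENNReal.rpow_lt_top_of_nonneg hp0.le ?_) (by simp)
    exact ENNReal.mul_ne_top ENNReal.ofReal_ne_top (by simp [J])
  refine (lintegral_Lp_lintegral_le (h.measurable_ite_flow t h.cont') hp hn hfin).trans ?_
  rw [setLIntegral_const, Real.volume_Icc, mul_comm]
  refine (mul_le_mul_left hlen _).trans_eq ?_
  rw [← ENNReal.ofReal_mul (by positivity), mul_assoc]

theorem lpEstimate (h : IsPosExtension v F F') (hv : IsPosC1 v) {u₀ b : ℝ → ℝ}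
    {u : ℝ → ℝ → ℝ} (hu : IsLogSolution u₀ b v u) (hu₀ : ContinuousOn u₀ (Icc 0 1))
    (hb : ContinuousOn b (Ici 0)) {t p μ : ℝ} (ht : 0 ≤ t) (hp : 1 < p) (hμ : 0 < μ)
    (hμ' : -(p⁻¹ * vmax v t) - vmin v t < μ) :
    normLp p (u t) ≤
      Real.exp (p⁻¹ * vmax v t * t) * stepH (t - 1 / vmin v t) * normLp p u₀
      + 1 / vmin v t * Real.exp (1 + (μ + p⁻¹ * vmax v t) / vmin v t) *
          memoryMax v t μ (fun s => normLp p (spaceDeriv v s))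
      + (vmin v t * ((Real.exp (p * μ / vmin v t) - 1) / (p * μ))) ^ (1 / p) *
          memoryMax v t μ (fun s => |b s|) := by
  have hp0 : 0 < p := zero_lt_one.trans hp
  have hm := hv.vmin_pos ht
  obtain ⟨Cb, hCb⟩ := (isCompact_Icc (a := 0) (b := t)).exists_bound_of_continuousOn
    (hb.mono Icc_subset_Ici_self)
  have hB := memoryMax_nonneg (v := v) hμ ht hm fun s hs => ⟨abs_nonneg (b s), hCb s hs⟩
  obtain ⟨C, hC⟩ := h.exists_abs_spaceDeriv_le t
  have hM := memoryMax_nonneg (v := v) hμ ht hm (g := fun s => normLp p (spaceDeriv v s))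
    fun s hs => ⟨normLp_nonneg _ _,
      normLp_le hp0 C.2 (hv.1.continuousOn_spaceDeriv_apply hs.1) (hC s hs)⟩
  have hstep : 0 ≤ stepH (t - 1 / vmin v t) := by unfold stepH; split_ifs <;> simp
  have hexp : 0 ≤ Real.exp (p * μ / vmin v t) - 1 :=
    sub_nonneg.2 (Real.one_le_exp (by positivity))
  let U : ℝ → ℝ := fun y => u₀ (max 0 (min 1 y))
  have hU : Continuous U := hu₀.comp_continuous (f := fun y : ℝ => max 0 (min 1 y))
    (by fun_prop) fun y => ⟨le_max_left _ _, max_le zero_le_one (min_le_left _ _)⟩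
  have hUe : ∀ y ∈ Icc (0 : ℝ) 1, U y = u₀ y := fun y hy => by
    simp only [U, max_min_of_mem hy]
  have hnU : normLp p U = normLp p u₀ := by
    rw [normLp, normLp]
    congr 1
    refine intervalIntegral.integral_congr fun y hy => ?_
    rw [uIcc_of_le zero_le_one] at hy
    simp only [hUe y hy]
  set J := Icc (max 0 (t - 1 / vmin v t)) t
  set B := memoryMax v t μ (fun s => |b s|)
  let f₁ : ℝ → ℝ≥0∞ := fun x => ENNReal.ofReal (stepH (t - 1 / vmin v t)) *
    (if 0 ≤ h.flow t x 0 then ‖U (h.flow t x 0)‖ₑ else 0)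
  let f₂ : ℝ → ℝ≥0∞ := fun x => ENNReal.ofReal (B * Real.exp (μ * x / vmin v t))
  -- The entry time depends on `x`. Integrating over the whole window, with a cutoff where the
  -- trajectory is left of 0, gives a fixed time domain and a jointly measurable integrand, as
  -- Minkowski's inequality needs.
  let f₃ : ℝ → ℝ≥0∞ := fun x => ∫⁻ s in J,
    (if 0 ≤ h.flow t x s then ‖F' s (h.flow t x s)‖ₑ else 0)
  have m₁ : Measurable f₁ :=
    ((h.measurable_ite_flow t (f := fun _ y => U y) (hU.comp continuous_snd)).comp
      (measurable_prodMk_right (y := (0 : ℝ)))).const_mul _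
  have m₂ : Measurable f₂ := by fun_prop
  have m₃ : Measurable f₃ := (h.measurable_ite_flow t h.cont').lintegral_prod_right
  have hpt : ∀ x ∈ Icc (0 : ℝ) 1, ‖u t x‖ₑ ≤ (f₁ + f₃ + f₂) x := fun x hx => by
    obtain ⟨s, hs, hs0, hle⟩ := h.exists_abs_le hv hu hμ ht hCb hx
    have hc : Continuous fun r => F' r (h.flow t x r) :=
      h.cont'.comp (continuous_id.prodMk (h.continuous_flow_time t x))
    have hint : 0 ≤ ∫ r in s..t, |F' r (h.flow t x r)| :=
      intervalIntegral.integral_nonneg hs.2 fun _ _ => abs_nonneg _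
    have h0 : 0 ≤ if 0 ≤ h.flow t x 0 then |u₀ (h.flow t x 0)| else 0 := by
      split_ifs <;> positivity
    have e1 : f₁ x = ENNReal.ofReal (stepH (t - 1 / vmin v t) *
        (if 0 ≤ h.flow t x 0 then |u₀ (h.flow t x 0)| else 0)) := by
      rw [ENNReal.ofReal_mul hstep]
      simp only [f₁]
      split_ifs with hf
      · rw [Real.enorm_eq_ofReal_abs, hUe _ (h.flow_mem hx.2 hf le_rfl ht)]
      · rw [ENNReal.ofReal_zero]
    have e3 : ENNReal.ofReal (∫ r in s..t, |F' r (h.flow t x r)|) ≤ f₃ x := by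
      rw [intervalIntegral.integral_of_le hs.2, ← integral_Icc_eq_integral_Ioc,
        ofReal_integral_eq_lintegral_ofReal hc.abs.continuousOn.integrableOn_Icc
          (ae_of_all _ fun _ => abs_nonneg _)]
      calc ∫⁻ r in Icc s t, ENNReal.ofReal |F' r (h.flow t x r)|
          = ∫⁻ r in Icc s t, (if 0 ≤ h.flow t x r then ‖F' r (h.flow t x r)‖ₑ else 0) := by
            refine setLIntegral_congr_fun measurableSet_Icc fun r hr => ?_
            simp only [if_pos (h.flow_mem hx.2 hs0 hr.1 hr.2).1, Real.enorm_eq_ofReal_abs]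
        _ ≤ f₃ x := lintegral_mono_set (Icc_subset_Icc_left hs.1)
    rw [Real.enorm_eq_ofReal_abs]
    refine (ENNReal.ofReal_le_ofReal hle).trans ?_
    rw [ENNReal.ofReal_add (by positivity) hint, ENNReal.ofReal_add (by positivity) (by positivity),
      Pi.add_apply, Pi.add_apply, e1, add_right_comm]
    gcongr
  have hcont : ContinuousOn (u t) (Icc 0 1) := fun x hx =>
    (hu.isC1.hasDerivWithinAt_space ht hx).continuousWithinAt
  have i₁ := h.initial_le hv.1 hU ht hp0 hstep
  have i₂ := lintegral_exp_rpow hB hm hp0 hμ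
  have i₃ := h.source_le hv ht hp hμ hμ'
  rw [hnU] at i₁
  have hT : 0 ≤ (vmin v t * ((Real.exp (p * μ / vmin v t) - 1) / (p * μ))) ^ (1 / p) * B := by
    positivity
  have hn0 := normLp_nonneg p u₀
  rw [← ENNReal.ofReal_le_ofReal_iff (by positivity), ofReal_normLp hp0 hcont,
    ENNReal.ofReal_add (by positivity) hT, ENNReal.ofReal_add (by positivity) (by positivity)]
  calc (∫⁻ x in Icc (0 : ℝ) 1, ‖u t x‖ₑ ^ p) ^ (1 / p)
      ≤ (∫⁻ x in Icc (0 : ℝ) 1, (f₁ + f₃ + f₂) x ^ p) ^ (1 / p) := by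
        refine ENNReal.rpow_le_rpow (setLIntegral_mono' measurableSet_Icc fun x hx => ?_)
          (one_div_nonneg.2 hp0.le)
        exact ENNReal.rpow_le_rpow (hpt x hx) hp0.le
    _ ≤ (∫⁻ x in Icc (0 : ℝ) 1, (f₁ + f₃) x ^ p) ^ (1 / p) +
          (∫⁻ x in Icc (0 : ℝ) 1, f₂ x ^ p) ^ (1 / p) :=
        ENNReal.lintegral_Lp_add_le (m₁.add m₃).aemeasurable m₂.aemeasurable hp.le
    _ ≤ (∫⁻ x in Icc (0 : ℝ) 1, f₁ x ^ p) ^ (1 / p) +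
          (∫⁻ x in Icc (0 : ℝ) 1, f₃ x ^ p) ^ (1 / p) +
          (∫⁻ x in Icc (0 : ℝ) 1, f₂ x ^ p) ^ (1 / p) := by
        gcongr
        exact ENNReal.lintegral_Lp_add_le m₁.aemeasurable m₃.aemeasurable hp.le
    _ ≤ _ := add_le_add (add_le_add i₁ i₃) i₂.le

end IsPosExtension

/-! ### One-variable tools for existence -/

theorem contDiff_one_of_hasDerivAt {f f' : ℝ → ℝ} (h : ∀ x, HasDerivAt f (f' x) x)
    (hf' : Continuous f') : ContDiff ℝ 1 f := by
  rw [contDiff_one_iff_deriv]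
  refine ⟨fun x => (h x).differentiableAt, ?_⟩
  rwa [funext fun x => (h x).deriv]

/-- A `C¹` function on the right half-line and one on the left half-line that agree to first order
at `0` are pieces of a `C¹` function on the line. -/
theorem exists_contDiff_glue {p q : ℝ → ℝ} (hp : ContDiffOn ℝ 1 p (Ici 0)) (hq : ContDiff ℝ 1 q)
    (h0 : p 0 = q 0) (h1 : derivWithin p (Ici 0) 0 = deriv q 0) :
    ∃ f : ℝ → ℝ, ContDiff ℝ 1 f ∧ (∀ t, 0 ≤ t → f t = p t) ∧ ∀ t, t ≤ 0 → f t = q t := by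
  set p' := derivWithin p (Ici 0)
  -- On each half-line one of the first two terms is the common derivative at 0, which the last term
  -- cancels.
  let f' : ℝ → ℝ := fun s => p' (max s 0) + deriv q (min s 0) - p' 0
  have cp : Continuous fun s : ℝ => p' (max s 0) :=
    (hp.continuousOn_derivWithin (uniqueDiffOn_Ici 0) le_rfl).comp_continuous
      (f := fun s : ℝ => max s 0) (by fun_prop) fun s => le_max_right s 0
  have cq : Continuous (deriv q) := hq.continuous_deriv le_rfl
  have cf' : Continuous f' :=
    (cp.add (cq.comp (continuous_id.min continuous_const))).sub continuous_const
  refine ⟨fun t => p 0 + ∫ s in (0 : ℝ)..t, f' s,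
    contDiff_one_of_hasDerivAt (f' := f') (fun t => ?_) cf', fun t ht => ?_, fun t ht => ?_⟩
  · exact (intervalIntegral.integral_hasDerivAt_right (cf'.intervalIntegrable _ _)
      cf'.aestronglyMeasurable.stronglyMeasurableAtFilter cf'.continuousAt).const_add _
  · have hd : ∀ s, 0 ≤ s → HasDerivWithinAt p (p' s) (Ici 0) s := fun s hs =>
      (hp.differentiableOn one_ne_zero s hs).hasDerivWithinAt
    have := intervalIntegral.integral_eq_sub_of_hasDerivAt_of_le ht (f := p) (f' := f')
      (hp.continuousOn.mono Icc_subset_Ici_self) (fun s hs => by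
        have e : f' s = p' s := by
          simp only [f', max_eq_left hs.1.le, min_eq_right hs.1.le, ← h1]
          ring
        rw [e]
        exact (hd s hs.1.le).hasDerivAt (Ici_mem_nhds hs.1))
      (cf'.intervalIntegrable _ _)
    simp only [this]
    ring
  · have := intervalIntegral.integral_eq_sub_of_hasDerivAt (a := 0) (b := t) (f := q) (f' := f')
      (fun s hs => by
        have hs' : s ≤ 0 := by
          rw [uIcc_of_ge ht] at hs
          exact hs.2
        have e : f' s = deriv q s := by
          simp only [f', max_eq_right hs', min_eq_left hs']
          ring
        rw [e]
        exact (hq.differentiable one_ne_zero s).hasDerivAt)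
      (cf'.intervalIntegrable _ _)
    simp only [this, h0]
    ring

theorem hasDerivAt_integral_of_continuous {f f' : ℝ → ℝ → ℝ} (a c : ℝ)
    (hf : Continuous (Function.uncurry f)) (hf' : Continuous (Function.uncurry f'))
    (hd : ∀ z s, HasDerivAt (fun z => f z s) (f' z s) z) (z : ℝ) :
    HasDerivAt (fun z => ∫ s in a..c, f z s) (∫ s in a..c, f' z s) z := by
  obtain ⟨C, hC⟩ := ((isCompact_Icc (a := z - 1) (b := z + 1)).prod
    (isCompact_uIcc (a := a) (b := c))).exists_bound_of_continuousOn hf'.continuousOn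
  have hs : ∀ z, Continuous (f z) := fun z => hf.comp (Continuous.prodMk_right z)
  have hs' : ∀ z, Continuous (f' z) := fun z => hf'.comp (Continuous.prodMk_right z)
  refine (intervalIntegral.hasDerivAt_integral_of_dominated_loc_of_deriv_le
    (bound := fun _ => C) (Icc_mem_nhds (sub_one_lt z) (lt_add_one z))
    (Eventually.of_forall fun z => (hs z).aestronglyMeasurable)
    ((hs z).intervalIntegrable _ _) (hs' z).aestronglyMeasurable
    (ae_of_all _ fun s hsm y hy => hC (y, s) ⟨hy, uIoc_subset_uIcc hsm⟩)
    intervalIntegrable_const (ae_of_all _ fun s _ y _ => hd y s)).2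

/-- The inverse of a `C¹` function with positive derivative is `C¹` on its range. -/
theorem contDiffAt_invFun {a a' : ℝ → ℝ} (ha : ∀ s, HasDerivAt a (a' s) s) (ca : Continuous a')
    (hpos : ∀ s, 0 < a' s) (s : ℝ) : ContDiffAt ℝ 1 (Function.invFun a) (a s) := by
  have hc : ContDiff ℝ 1 a := contDiff_one_of_hasDerivAt ha ca
  have hinj : Function.Injective a := (strictMono_of_deriv_pos fun s => by
    rw [(ha s).deriv]
    exact hpos s).injective
  let e : ℝ ≃L[ℝ] ℝ := ContinuousLinearEquiv.unitsEquivAut ℝ (Units.mk0 (a' s) (hpos s).ne')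
  have he : HasFDerivAt a (e : ℝ →L[ℝ] ℝ) s := (ha s).hasFDerivAt_equiv (hpos s).ne'
  have hstrict : HasStrictFDerivAt a (e : ℝ →L[ℝ] ℝ) s :=
    hc.contDiffAt.hasStrictFDerivAt' he one_ne_zero
  refine (hc.contDiffAt.to_localInverse he one_ne_zero).congr_of_eventuallyEq ?_
  filter_upwards [hstrict.eventually_right_inverse] with y hy
  change Function.invFun a y = hstrict.localInverse a e s y
  conv_lhs => rw [← hy]
  exact Function.leftInverse_invFun hinj _

theorem IsLogSolution.isSolution {ρs : ℝ} (hρs : 0 < ρs) {ρ0 b : ℝ → ℝ} {v u : ℝ → ℝ → ℝ}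
    (hρ0 : ∀ x ∈ Icc (0 : ℝ) 1, 0 < ρ0 x)
    (h : IsLogSolution (fun x => Real.log (ρ0 x / ρs)) b v u) :
    IsSolution ρs ρ0 b v (fun t x => ρs * Real.exp (u t x)) := by
  refine ⟨⟨?_, fun t x _ _ => mul_pos hρs (Real.exp_pos _)⟩, fun t x ht hx => ?_, fun t ht => ?_,
    fun x hx => ?_⟩
  · exact contDiffOn_const.mul h.isC1.exp
  · have hp := HasFDerivWithinAt.partials (h.isC1.hasFDerivWithinAt ht hx) ht hx
    have e1 := timeDeriv_eq (u := fun t x => ρs * Real.exp (u t x)) ht (hp.1.exp.const_mul ρs)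
    have e2 := spaceDeriv_eq (u := fun t x => ρs * Real.exp (u t x)) hx (hp.2.exp.const_mul ρs)
    have := h.pde t x ht hx
    rw [timeDeriv_eq ht hp.1, spaceDeriv_eq hx hp.2] at this
    rw [e1, e2]
    linear_combination ρs * Real.exp (u t x) * this
  · simp only [h.boundary t ht]
  · simp only [h.initial x (Ioc_subset_Icc_self hx)]
    rw [Real.exp_log (div_pos (hρ0 x (Ioc_subset_Icc_self hx)) hρs), mul_div_cancel₀ _ hρs.ne']

/-! ### Integrals along trajectories -/

namespace IsVelocity

variable {F F' g g' : ℝ → ℝ → ℝ}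

/-- The integral over `[0, t]` of `g` along the trajectory that starts at `z` at time `0`. -/
def accum (h : IsVelocity F F') (g : ℝ → ℝ → ℝ) (t z : ℝ) : ℝ :=
  ∫ s in (0 : ℝ)..t, g s (h.flow 0 z s)

/-- The space derivative of `accum`, where `g'` is the space derivative of `g`. -/
def accumDeriv (h : IsVelocity F F') (g' : ℝ → ℝ → ℝ) (t z : ℝ) : ℝ :=
  ∫ s in (0 : ℝ)..t, g' s (h.flow 0 z s) * h.flowDeriv 0 z s

theorem continuous_along (h : IsVelocity F F') (hg : Continuous (Function.uncurry g)) :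
    Continuous (Function.uncurry fun z s => g s (h.flow 0 z s)) :=
  hg.comp (continuous_snd.prodMk
    (h.continuous_flow_comp continuous_const continuous_fst continuous_snd))

theorem continuous_along_mul (h : IsVelocity F F') (hg' : Continuous (Function.uncurry g')) :
    Continuous (Function.uncurry fun z s => g' s (h.flow 0 z s) * h.flowDeriv 0 z s) :=
  (h.continuous_along hg').mul
    (h.continuous_flowDeriv.comp (continuous_const.prodMk (continuous_fst.prodMk continuous_snd)))

theorem hasDerivAt_accum_time (h : IsVelocity F F') (hg : Continuous (Function.uncurry g))
    (t z : ℝ) : HasDerivAt (fun s => h.accum g s z) (g t (h.flow 0 z t)) t := by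
  have hc : Continuous fun s => g s (h.flow 0 z s) :=
    (h.continuous_along hg).comp (Continuous.prodMk_right z)
  exact intervalIntegral.integral_hasDerivAt_right (hc.intervalIntegrable _ _)
    hc.aestronglyMeasurable.stronglyMeasurableAtFilter hc.continuousAt

theorem hasDerivAt_accum_space (h : IsVelocity F F') (hg : Continuous (Function.uncurry g))
    (hg' : Continuous (Function.uncurry g')) (hd : ∀ t x, HasDerivAt (g t) (g' t x) x) (t z : ℝ) :
    HasDerivAt (h.accum g t) (h.accumDeriv g' t z) z :=
  hasDerivAt_integral_of_continuous 0 t (h.continuous_along hg) (h.continuous_along_mul hg')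
    (fun z s => (hd s _).comp z (h.hasDerivAt_flow_space 0 z s)) z

theorem continuous_accum_time (h : IsVelocity F F') (hg : Continuous (Function.uncurry g)) :
    Continuous (Function.uncurry fun t z => g t (h.flow 0 z t)) :=
  (h.continuous_along hg).comp continuous_swap

theorem continuous_accumDeriv (h : IsVelocity F F') (hg' : Continuous (Function.uncurry g')) :
    Continuous (Function.uncurry (h.accumDeriv g')) :=
  continuous_primitive_two (f := fun (q : ℝ × ℝ) s => g' s (h.flow 0 q.2 s) * h.flowDeriv 0 q.2 s)
    ((h.continuous_along_mul hg').comp (f := fun p : (ℝ × ℝ) × ℝ => (p.1.2, p.2)) (by fun_prop))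
    continuous_const continuous_fst

theorem contDiff_accum (h : IsVelocity F F') (hg : Continuous (Function.uncurry g))
    (hg' : Continuous (Function.uncurry g')) (hd : ∀ t x, HasDerivAt (g t) (g' t x) x) :
    ContDiff ℝ 1 (Function.uncurry (h.accum g)) :=
  contDiff_of_partials (fun t z => h.hasDerivAt_accum_time hg t z)
    (fun t z => h.hasDerivAt_accum_space hg hg' hd t z)
    (h.continuous_accum_time hg) (h.continuous_accumDeriv hg')

theorem contDiff_flow_along (h : IsVelocity F F') (x : ℝ) :
    ContDiff ℝ 1 fun t => h.flow t x 0 :=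
  (h.contDiff_flow 0).comp (f := fun t : ℝ => (t, x)) (by fun_prop)

end IsVelocity

/-! ### Existence -/

namespace IsPosExtension

variable {v F F' : ℝ → ℝ → ℝ}

/-- Every trajectory through a point of the domain has passed through `0`. -/
theorem exists_crossing (h : IsPosExtension v F F') {t x : ℝ} (ht : 0 ≤ t)
    (hx : x ∈ Icc (0 : ℝ) 1) : ∃ s, h.flow t x s = 0 := by
  rcases le_total (h.flow t x 0) 0 with h0 | h0
  · obtain ⟨s, -, hs⟩ := h.exists_flow_eq_zero ht hx.1 h0
    exact ⟨s, hs⟩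
  have h1 := (h.flow_mem hx.2 h0 le_rfl ht).2
  have hF : Continuous (F 0) := h.cont.comp (Continuous.prodMk_right 0)
  obtain ⟨y, -, hy⟩ := (isCompact_Icc (a := (0 : ℝ)) (b := 1)).exists_isMinOn
    (nonempty_Icc.2 zero_le_one) hF.continuousOn
  have hc : 0 < F 0 y := h.pos 0 y
  have hneg : -(1 / F 0 y) ≤ 0 := neg_nonpos.2 (one_div_pos.2 hc).le
  -- Before time 0 the field is stationary, with minimum F 0 y on [0, 1]. Going back by 1 / F 0 y
  -- without reaching 0 would mean covering at least unit length from a positive position,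
  -- contradicting flow ≤ 1 at time 0.
  have hle : h.flow t x (-(1 / F 0 y)) ≤ 0 := by
    by_contra hlt
    push Not at hlt
    have hm := (h.strictMono_flow_time t x).monotone
    have := (convex_Icc (-(1 / F 0 y)) 0).mul_sub_le_image_sub_of_le_deriv
      (h.continuous_flow_time t x).continuousOn
      (fun r _ => (h.hasDerivAt_flow t x r).differentiableAt.differentiableWithinAt)
      (C := F 0 y) (fun r hr => by
        have hr' := interior_subset hr
        rw [(h.hasDerivAt_flow t x r).deriv, h.eq_zero_time _ _ hr'.2]
        exact hy ⟨hlt.le.trans (hm hr'.1), (hm hr'.2).trans h1⟩)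
      (-(1 / F 0 y)) (left_mem_Icc.2 hneg) 0 (right_mem_Icc.2 hneg) hneg
    rw [zero_sub, neg_neg, mul_one_div_cancel hc.ne'] at this
    linarith
  obtain ⟨s, -, hs⟩ := intermediate_value_Icc hneg (h.continuous_flow_time t x).continuousOn
    ⟨hle, h0⟩
  exact ⟨s, hs⟩

/-- In terms of the label ζ the equation integrates explicitly, and initial and boundary data merge
into one function Q of the label. All matching takes place in one variable, so no C¹ gluing across
the characteristic from the corner is needed. -/
theorem exists_isLogSolution (h : IsPosExtension v F F') (hv : IsC1 (spaceDeriv v))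
    {u₀ b : ℝ → ℝ} (hu₀ : ContDiffOn ℝ 1 u₀ (Icc 0 1)) (hb : ContDiffOn ℝ 1 b (Ici 0))
    (h0 : u₀ 0 = b 0)
    (h1 : spaceDeriv v 0 0 =
      -derivWithin b (Ici 0) 0 - v 0 0 * derivWithin u₀ (Icc 0 1) 0) :
    ∃ u, IsLogSolution u₀ b v u := by
  have z01 : (0 : ℝ) ∈ Icc (0 : ℝ) 1 := ⟨le_rfl, zero_le_one⟩
  -- the source term on the plane
  have hk := hv.continuousOn_spaceDeriv
  -- This extension, and not `F'`, serves as the source: it is differentiable in space on the whole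
  -- plane, which makes H a C¹ function, and the equation only needs its values on the domain.
  set g := extend (spaceDeriv v) (spaceDeriv (spaceDeriv v))
  set g' := retract (spaceDeriv (spaceDeriv v))
  have cg : Continuous (Function.uncurry g) := continuous_extend hv.continuousOn hk
  have cg' : Continuous (Function.uncurry g') := continuous_retract hk
  have hgd : ∀ t x, HasDerivAt (g t) (g' t x) x := hasDerivAt_extend _ hk
  have hgv : ∀ t x, 0 ≤ t → x ∈ Icc (0 : ℝ) 1 → g t x = spaceDeriv v t x := fun t x ht hx =>
    extend_eq hk ht hx fun y hy => hv.hasDerivWithinAt_space ht hy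
  -- the initial profile on the line
  have cu : ContinuousOn (Function.uncurry fun _ : ℝ => derivWithin u₀ (Icc 0 1)) domain :=
    (hu₀.continuousOn_derivWithin (uniqueDiffOn_Icc zero_lt_one) le_rfl).comp continuousOn_snd
      fun q hq => hq.2
  set w := extend (fun _ => u₀) (fun _ => derivWithin u₀ (Icc 0 1)) 0
  have hwd : ∀ x, HasDerivAt w (retract (fun _ => derivWithin u₀ (Icc 0 1)) 0 x) x :=
    hasDerivAt_extend _ cu 0
  have cw : ContDiff ℝ 1 w := contDiff_one_of_hasDerivAt hwd
    ((continuous_retract cu).comp (Continuous.prodMk_right 0))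
  have hw : ∀ x ∈ Icc (0 : ℝ) 1, w x = u₀ x := fun x hx =>
    extend_eq cu le_rfl hx fun y hy =>
      (hu₀.differentiableOn one_ne_zero y hy).hasDerivWithinAt
  -- the boundary data on the line
  let ζ : ℝ → ℝ → ℝ := fun t x => h.flow t x 0
  let H := h.accum g
  have cH : ContDiff ℝ 1 (Function.uncurry H) := h.contDiff_accum cg cg' hgd
  have hHf := hasFDerivAt_of_partials (fun t z => h.hasDerivAt_accum_time cg t z)
    (fun t z => h.hasDerivAt_accum_space cg cg' hgd t z)
    (h.continuous_accum_time cg) (h.continuous_accumDeriv cg')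
  have hH0 : ∀ z, H 0 z = 0 := fun z => intervalIntegral.integral_same
  let K : ℝ → ℝ := fun t => H t (ζ t 0)
  have cK : ContDiff ℝ 1 K := cH.comp (contDiff_id.prodMk (h.contDiff_flow_along 0))
  let W : ℝ → ℝ := fun t => w (ζ t 0)
  have cW : ContDiff ℝ 1 W := cw.comp (h.contDiff_flow_along 0)
  have hζ00 : ζ 0 0 = 0 := h.flow_self 0 0
  have hζd : HasDerivAt (fun t => ζ t 0) (-v 0 0) 0 := by
    have := h.hasDerivAt_flow_start 0 0 0
    rwa [IsVelocity.flowDeriv, intervalIntegral.integral_same, Real.exp_zero, mul_one,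
      h.eq 0 0 le_rfl z01] at this
  have hKd : HasDerivAt K (spaceDeriv v 0 0) 0 := by
    have := (hHf (0, ζ 0 0)).comp_hasDerivAt (f := fun t => (t, ζ t 0)) 0
      ((hasDerivAt_id 0).prodMk hζd)
    refine this.congr_deriv ?_
    simp [hζ00, h.flow_self, hgv 0 0 le_rfl z01, IsVelocity.accumDeriv]
  have hWd : HasDerivAt W (derivWithin u₀ (Icc 0 1) 0 * -v 0 0) 0 := by
    have := (hwd (ζ 0 0)).comp (h := fun t => ζ t 0) 0 hζd
    rwa [hζ00, retract_eq _ le_rfl z01] at this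
  -- For t ≤ 0 the boundary value W - K is the one that leads to the initial profile at time 0.
  -- Values and derivatives match at 0 by the compatibility conditions.
  obtain ⟨B, cB, hBr, hBl⟩ := exists_contDiff_glue (q := fun t => W t - K t) hb (cW.sub cK)
    (by simp only [W, K, hζ00, hH0, hw 0 z01, h0, sub_zero])
    (by
      have : deriv (fun t => W t - K t) 0 = _ := (hWd.sub hKd).deriv
      rw [this]
      linarith)
  -- the crossing time
  let a : ℝ → ℝ := fun t => -ζ t 0
  have ha : ∀ s, HasDerivAt a (-(-F s 0 * h.flowDeriv s 0 0)) s := fun s =>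
    (h.hasDerivAt_flow_start s 0 0).neg
  have ca : Continuous fun s => -(-F s 0 * h.flowDeriv s 0 0) :=
    ((h.continuous_neg_mul_flowDeriv 0).comp (f := fun s : ℝ => (s, (0 : ℝ))) (by fun_prop)).neg
  have hapos : ∀ s, 0 < -(-F s 0 * h.flowDeriv s 0 0) := fun s => by
    rw [neg_mul, neg_neg]
    exact mul_pos (h.pos _ _) (h.flowDeriv_pos _ _ _)
  have hainj : Function.Injective a := (strictMono_of_deriv_pos fun s => by
    rw [(ha s).deriv]
    exact hapos s).injective
  have hcross : ∀ t x s, h.flow t x s = 0 → -ζ t x = a s := fun t x s hs => by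
    simp only [a, ζ]
    rw [← h.flow_flow t x s, hs]
  have hinv : ∀ t x s, h.flow t x s = 0 → Function.invFun a (-ζ t x) = s := fun t x s hs => by
    rw [hcross t x s hs]
    exact Function.leftInverse_invFun hainj s
  -- The argument of B and K is the time at which the trajectory with label `z` crosses x = 0;
  -- adding K undoes the subtraction of H at that time.
  let Q : ℝ → ℝ := fun z => B (Function.invFun a (-z)) + K (Function.invFun a (-z))
  have cQ : ∀ t x, 0 ≤ t → x ∈ Icc (0 : ℝ) 1 → ContDiffAt ℝ 1 Q (ζ t x) := fun t x ht hx => by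
    obtain ⟨s, hs⟩ := h.exists_crossing ht hx
    have hi : ContDiffAt ℝ 1 (fun z => Function.invFun a (-z)) (ζ t x) := by
      refine ContDiffAt.comp (ζ t x) (g := Function.invFun a) ?_ contDiffAt_id.neg
      rw [hcross t x s hs]
      exact contDiffAt_invFun ha ca hapos s
    exact (cB.contDiffAt.comp _ hi).add (cK.contDiffAt.comp _ hi)
  have cζ : ContDiff ℝ 1 fun q : ℝ × ℝ => ζ q.1 q.2 := h.contDiff_flow 0
  refine ⟨fun t x => Q (ζ t x) - H t (ζ t x), fun q hq => ?_, fun t x ht hx => ?_, fun t ht => ?_,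
    fun x hx => ?_⟩
  · refine ContDiffAt.contDiffWithinAt (ContDiffAt.sub ?_ ?_)
    · exact (cQ q.1 q.2 hq.1 hq.2).comp q cζ.contDiffAt
    · exact (cH.comp (contDiff_fst.prodMk cζ)).contDiffAt
  · have hQ := ((cQ t x ht hx).differentiableAt one_ne_zero).hasDerivAt
    have hζt := h.hasDerivAt_flow_start t x 0
    have hζx := h.hasDerivAt_flow_space t x 0
    have ut := (hQ.comp t hζt).sub ((hHf (t, ζ t x)).comp_hasDerivAt (f := fun s => (s, ζ s x)) t
      ((hasDerivAt_id t).prodMk hζt))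
    have ux := (hQ.comp x hζx).sub ((hHf (t, ζ t x)).comp_hasDerivAt (f := fun y => (t, ζ t y)) x
      ((hasDerivAt_const x t).prodMk hζx))
    rw [timeDeriv_eq (u := fun t x => Q (ζ t x) - H t (ζ t x)) ht ut.hasDerivWithinAt,
      spaceDeriv_eq (u := fun t x => Q (ζ t x) - H t (ζ t x)) hx ux.hasDerivWithinAt,
      ← hgv t x ht hx, ← h.eq t x ht hx]
    have e : h.flow 0 (ζ t x) t = x := by
      simp only [ζ]
      rw [h.flow_flow, h.flow_self]
    simp [e]
    ring
  · simp only [Q]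
    rw [hinv t 0 t (h.flow_self t 0), hBr t ht]
    simp only [K]
    ring
  · obtain ⟨s, hs⟩ := h.exists_crossing le_rfl hx
    have hs0 : s ≤ 0 := by
      rw [← (h.strictMono_flow_time 0 x).le_iff_le, hs, h.flow_self]
      exact hx.1
    have hζs : ζ s 0 = x := by
      have := h.flow_flow 0 x s 0
      rwa [hs, h.flow_self] at this
    simp only [Q]
    rw [hinv 0 x s hs, hBl s hs0, hH0]
    simp only [W, hζs, hw x hx]
    ring

end IsPosExtension

end

end ContinuityEq

open ContinuityEq

/-! ### The theorem -/

theorem theorem2p1 (ρs : ℝ) (hρs : 0 < ρs)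
    (ρ0 : ℝ → ℝ) (hρ0 : ContDiffOn ℝ 1 ρ0 (Set.Icc 0 1))
    (hρ0pos : ∀ x ∈ Set.Icc (0 : ℝ) 1, 0 < ρ0 x)
    (b : ℝ → ℝ) (hb : ContDiffOn ℝ 1 b (Set.Ici 0))
    (v : ℝ → ℝ → ℝ) (hv : IsPosC1 v)
    (hcomp0 : ρs * Real.exp (b 0) = ρ0 0)
    (hcomp1 : spaceDeriv v 0 0 =
      -derivWithin b (Set.Ici 0) 0 - v 0 0 * (derivWithin ρ0 (Set.Icc 0 1) 0 / ρ0 0)) :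
    -- existence
    (IsC1 (spaceDeriv v) → ∃ ρ : ℝ → ℝ → ℝ, IsSolution ρs ρ0 b v ρ) ∧
    -- uniqueness
    (∀ ρ₁ ρ₂ : ℝ → ℝ → ℝ, IsSolution ρs ρ0 b v ρ₁ → IsSolution ρs ρ0 b v ρ₂ →
      ∀ t x : ℝ, 0 ≤ t → x ∈ Set.Icc (0 : ℝ) 1 → ρ₁ t x = ρ₂ t x) ∧
    -- stability estimates
    (∀ ρ : ℝ → ℝ → ℝ, IsSolution ρs ρ0 b v ρ →
      ∀ t p μ : ℝ, 0 ≤ t → 1 < p → 0 < μ → -(p⁻¹ * vmax v t) - vmin v t < μ →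
        LpEstimate ρs ρ0 b v ρ t p μ ∧ SupEstimate ρs ρ0 b v ρ t μ) := by
  obtain ⟨F, F', h⟩ := hv.exists_isPosExtension
  have hne : ∀ x ∈ Set.Icc (0 : ℝ) 1, ρ0 x / ρs ≠ 0 := fun x hx => (div_pos (hρ0pos x hx) hρs).ne'
  have hu₀ : ContDiffOn ℝ 1 (fun x => Real.log (ρ0 x / ρs)) (Set.Icc 0 1) :=
    (hρ0.div_const ρs).log hne
  have z01 : (0 : ℝ) ∈ Set.Icc (0 : ℝ) 1 := ⟨le_rfl, zero_le_one⟩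
  refine ⟨fun hv1 => ?_, fun ρ₁ ρ₂ h₁ h₂ t x ht hx => ?_, fun ρ hρ t p μ ht hp hμ hμ' => ?_⟩
  · obtain ⟨u, hu⟩ := h.exists_isLogSolution hv1 hu₀ hb
      (by simp only [← hcomp0, mul_div_cancel_left₀ _ hρs.ne', Real.log_exp])
      -- The logarithmic derivative of ρ0/ρs at 0 is ρ0'(0)/ρ0(0), so this is the first-order
      -- compatibility condition.
      (by
        have hd := (hρ0.differentiableOn one_ne_zero 0 z01).hasDerivWithinAt
        rw [((hd.div_const ρs).log (hne 0 z01)).derivWithin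
          (uniqueDiffOn_Icc zero_lt_one 0 z01), hcomp1, div_div_div_cancel_right₀ hρs.ne'])
    exact ⟨_, hu.isSolution hρs hρ0pos⟩
  · have := h.eq_of_isLogSolution (h₁.isLogSolution hρs hcomp0) (h₂.isLogSolution hρs hcomp0) ht hx
    have := Real.log_injOn_pos (div_pos (h₁.posC1.2 t x ht hx) hρs)
      (div_pos (h₂.posC1.2 t x ht hx) hρs) this
    exact (div_left_inj' hρs.ne').1 this
  · have hu := hρ.isLogSolution hρs hcomp0
    exact ⟨h.lpEstimate hv hu hu₀.continuousOn hb.continuousOn ht hp hμ hμ',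
      h.supEstimate hv hu hu₀.continuousOn hb.continuousOn ht hμ⟩
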